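/- Let $k$ be an algebraically closed field, and let $n\ge 2$, $\lambda\ge 1$, $m\ge 2$ be integers with $\operatorname{char} k\nmid n$. For $1\le i\le\lambda$ let $$h_i(z)=z^n+c_{1,i}z^{n-1}+\cdots+c_{n-1,i}z+1\in k[z],$$ and let $C=C_{n,\lambda,m}$ be the (smooth projective) curve with affine equation $$Y^n=f(X),\qquad f(X)=\prod_{i=1}^{\lambda}h_i(X^m).$$ Assume that $f$ has nonzero discriminant and that $(n-1)\lambda m>2$ (that is, the genus $1+\frac n2\left((n-1)\lambda m-2\right)$ of $C$ is at least $2$). Let $G=\operatorname{Aut}(C)$ be the full automorphism group of $C$ over $k$, i.e. the group of $k$-automorphisms of the function field $k(x,y)$ of $C$; let $\zeta_n\in k$ be a primitive $n$-th root of unity and let $\theta\in G$ be the automorphism $(x,y)\mapsto(x,\zeta_n y)$. Write $C_j$ for the cyclic group of order $j$ and $D_{2j}$ for the dihedral group of order $2j$. Then $\langle\theta\rangle$ is normal in $G$, and, with $\overline{G}=G/\langle\theta\rangle$ the reduced automorphism group of $C$, the following hold. a) If $\overline{G}\cong C_m$, then $G\cong C_{mn}$, or $$G\cong\langle\gamma,\sigma\mid\gamma^n=1,\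 \sigma^m=1,\ \sigma\gamma\sigma^{-1}=\gamma^l\rangle$$ for some integer $l\geq 0$ with $\gcd(l,n)=1$ and $l^m\equiv 1\pmod n$, where moreover $l=n-1$ if $\gcd(m,n)=1$. b) Suppose $\overline{G}\cong D_{2m}$, and consider the groups $$\begin{aligned} G_1&=\langle\gamma,\sigma,\tau\mid\gamma^n=1,\ \sigma^2=\gamma,\ \tau^2=1,\ (\sigma\tau)^m=1,\ \sigma\gamma\sigma^{-1}=\gamma,\ \tau\gamma\tau^{-1}=\gamma^{n-1}\rangle,\\ G_2&=\langle\gamma,\sigma,\tau\mid\gamma^n=1,\ \sigma^2=\gamma,\ \tau^2=\gamma^{n-1},\ (\sigma\tau)^m=1,\ \sigma\gamma\sigma^{-1}=\gamma,\ \tau\gamma\tau^{-1}=\gamma\rangle,\\ G_3&=\langle\gamma,\sigma,\tau\mid\gamma^n=1,\ \sigma^2=\gamma,\ \tau^2=1,\ (\sigma\tau)^m=\gamma^{n/2},\ \sigma\gamma\sigma^{-1}=\gamma,\ \tau\gamma\tau^{-1}=\gamma^{n-1}\rangle,\\ G_4&=\langle\gamma,\sigma,\tau\mid\gamma^n=1,\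 \sigma^2=\gamma,\ \tau^2=\gamma^{n-1},\ (\sigma\tau)^m=\gamma^{n/2},\ \sigma\gamma\sigma^{-1}=\gamma,\ \tau\gamma\tau^{-1}=\gamma\rangle. \end{aligned}$$ 1. If $n$ is odd, then $G\cong D_{2m}\times C_n$. 2. If $n$ is even and $m$ is odd, then $G\cong D_{2m}\times C_n$ or $G\cong G_4$. 3. If $n$ and $m$ are both even, then $G$ is isomorphic to one of $D_{2m}\times C_n$, $D_{2mn}$, $G_1$, $G_2$, $G_3$, $G_4$. -/

import Mathlib

open Polynomial

/-- The polynomial `h(z, 1) = z^n + c₁ z^(n-1) + ⋯ + c_(n-1) z + 1`.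
Only the values `c 1, …, c (n-1)` are used. -/
noncomputable def hPoly {k : Type*} [Field k] (n : ℕ) (c : ℕ → k) : k[X] :=
  X ^ n + ∑ j ∈ Finset.Ico 1 n, C (c j) * X ^ (n - j) + 1

/-- The right-hand side `f(X) = ∏ i, h_i(X^m, 1)` of the equation `Y^n = f(X)` of the curve
`C_{n, lam, m}` with coefficients `c i j`. -/
noncomputable def curvePoly {k : Type*} [Field k] (n lam m : ℕ) (c : Fin lam → ℕ → k) : k[X] :=
  ∏ i, (hPoly n (c i)).comp (X ^ m)

/-- The function field `k(x, y) = k(x)[Y] / (Y^n - f(x))` of the curve `Y^n = f(X)`. -/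
abbrev SuperellipticField {k : Type*} [Field k] (n : ℕ) (f : k[X]) : Type _ :=
  AdjoinRoot ((X : (RatFunc k)[X]) ^ n - C (algebraMap k[X] (RatFunc k) f))

/-- The automorphism group over `k` of the (smooth projective) curve `Y^n = f(X)`:
the group of `k`-automorphisms of its function field. -/
abbrev CurveAut {k : Type*} [Field k] (n : ℕ) (f : k[X]) : Type _ :=
  SuperellipticField n f ≃ₐ[k] SuperellipticField n f

/-- The `k(x)`-algebra endomorphism `y ↦ ζ y` of `k(x, y)`, for `ζ ^ n = 1`. -/
noncomputable def scaleHom {k : Type*} [Field k] (n : ℕ) (f : k[X]) (ζ : kˣ) (hζ : ζ ^ n = 1) :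
    SuperellipticField n f →ₐ[RatFunc k] SuperellipticField n f :=
  AdjoinRoot.liftAlgHom _ (Algebra.ofId (RatFunc k) (SuperellipticField n f))
    ((ζ : k) • AdjoinRoot.root _) (by
      have h : (AdjoinRoot.root ((X : (RatFunc k)[X]) ^ n -
          C (algebraMap k[X] (RatFunc k) f))) ^ n
          = AdjoinRoot.of _ (algebraMap k[X] (RatFunc k) f) := by
        have h0 := AdjoinRoot.eval₂_root ((X : (RatFunc k)[X]) ^ n -
          C (algebraMap k[X] (RatFunc k) f))
        simpa [sub_eq_zero] using h0
      have h1 : (ζ : k) ^ n = 1 := by simpa using congrArg Units.val hζ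
      simp only [eval₂_sub, eval₂_X_pow, eval₂_C]
      rw [_root_.smul_pow, h1, one_smul, h]
      exact sub_self _)

theorem scaleHom_comp {k : Type*} [Field k] (n : ℕ) (f : k[X]) (ζ ξ : kˣ)
    (hζ : ζ ^ n = 1) (hξ : ξ ^ n = 1) (h : ζ * ξ = 1) :
    (scaleHom n f ζ hζ).comp (scaleHom n f ξ hξ) = AlgHom.id (RatFunc k) _ := by
  apply AdjoinRoot.algHom_ext
  have h1 : (ξ : k) * (ζ : k) = 1 := by
    rw [mul_comm]; simpa using congrArg Units.val h
  have key : ∀ a : k, (scaleHom n f ζ hζ) (a • AdjoinRoot.root _)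
      = a • (scaleHom n f ζ hζ) (AdjoinRoot.root _) := fun a =>
    map_smul ((scaleHom n f ζ hζ).restrictScalars k) a _
  have e : ∀ (ω : kˣ) (hω : ω ^ n = 1), scaleHom n f ω hω (AdjoinRoot.root _)
      = (ω : k) • AdjoinRoot.root _ := fun ω hω => by
    simp [scaleHom]
  rw [AlgHom.comp_apply, e ξ hξ, key, e ζ hζ, smul_smul, h1, one_smul]
  rfl

/-- The superelliptic automorphism `(x, y) ↦ (x, ζ y)`, for `ζ ^ n = 1`. -/
noncomputable def superellipticAut {k : Type*} [Field k] (n : ℕ) (f : k[X]) (ζ : kˣ)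
    (hζ : ζ ^ n = 1) : CurveAut n f :=
  (AlgEquiv.ofAlgHom (scaleHom n f ζ hζ) (scaleHom n f ζ⁻¹ (by rw [inv_pow, hζ, inv_one]))
    (scaleHom_comp n f _ _ _ _ (mul_inv_cancel ζ))
    (scaleHom_comp n f _ _ _ _ (inv_mul_cancel ζ))).restrictScalars k

theorem superellipticAut_root {k : Type*} [Field k] (n : ℕ) (f : k[X]) (ζ : kˣ)
    (hζ : ζ ^ n = 1) : superellipticAut n f ζ hζ (AdjoinRoot.root _)
      = (ζ : k) • AdjoinRoot.root _ := by
  simp [superellipticAut, scaleHom]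

theorem superellipticAut_of {k : Type*} [Field k] (n : ℕ) (f : k[X]) (ζ : kˣ)
    (hζ : ζ ^ n = 1) (a : RatFunc k) :
    superellipticAut n f ζ hζ (AdjoinRoot.of _ a) = AdjoinRoot.of _ a :=
  (scaleHom n f ζ hζ).commutes a

/-- The cyclic group of order `n` (for `n ≥ 1`), written multiplicatively. -/
abbrev CyclicGrp (n : ℕ) : Type := Multiplicative (ZMod n)

/-- `⟨γ, σ | γ^n = 1, σ^m = 1, σ γ σ⁻¹ = γ^l⟩`. -/
abbrev MetacyclicGrp (n m l : ℕ) : Type :=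
  let γ : FreeGroup (Fin 2) := FreeGroup.of 0
  let σ : FreeGroup (Fin 2) := FreeGroup.of 1
  PresentedGroup ({γ ^ n, σ ^ m, σ * γ * σ⁻¹ * (γ ^ l)⁻¹} : Set (FreeGroup (Fin 2)))

/-- `⟨γ, σ, τ | γ^n = 1, σ² = γ, τ² = γ^a, (στ)^m = γ^b, σ γ σ⁻¹ = γ, τ γ τ⁻¹ = γ^c⟩`. -/
abbrev ExtGrp (n m a b c : ℕ) : Type :=
  let γ : FreeGroup (Fin 3) := FreeGroup.of 0
  let σ : FreeGroup (Fin 3) := FreeGroup.of 1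
  let τ : FreeGroup (Fin 3) := FreeGroup.of 2
  PresentedGroup ({γ ^ n, σ ^ 2 * γ⁻¹, τ ^ 2 * (γ ^ a)⁻¹, (σ * τ) ^ m * (γ ^ b)⁻¹,
    σ * γ * σ⁻¹ * γ⁻¹, τ * γ * τ⁻¹ * (γ ^ c)⁻¹} : Set (FreeGroup (Fin 3)))

/-- `G₁`: `τ² = 1`, `(στ)^m = 1`, `τ γ τ⁻¹ = γ^(n-1)`. -/
abbrev GroupG1 (n m : ℕ) : Type := ExtGrp n m 0 0 (n - 1)

/-- `G₂`: `τ² = γ^(n-1)`, `(στ)^m = 1`, `τ γ τ⁻¹ = γ`. -/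
abbrev GroupG2 (n m : ℕ) : Type := ExtGrp n m (n - 1) 0 1

/-- `G₃`: `τ² = 1`, `(στ)^m = γ^(n/2)`, `τ γ τ⁻¹ = γ^(n-1)`. -/
abbrev GroupG3 (n m : ℕ) : Type := ExtGrp n m 0 (n / 2) (n - 1)

/-- `G₄`: `τ² = γ^(n-1)`, `(στ)^m = γ^(n/2)`, `τ γ τ⁻¹ = γ`. -/
abbrev GroupG4 (n m : ℕ) : Type := ExtGrp n m (n - 1) (n / 2) 1

/-! The crux is that `x` is canonical up to fractional linear transformations: for every
automorphism σ, the function `x' = σ x` is a Möbius transform of `x` (`exists_mobius`). Take a root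
`a'` of `f` and the place `O` over `x' = a'`. It is totally ramified, so `z = 1/(x' - a')` has a
pole of order `n` at `O` and no other pole. Split `z` into its θ-eigencomponents `Q_b(x) y^b /
D(x)`, and write `deg f = n e`.

If `O` is also totally ramified over the `x`-line, at a root `a`, comparing pole orders kills all
components with `b > 0`, and `(x - a) z` is linear in `x` (`exists_linear_of_ramified`). If `O` is
unramified, its conjugates under θ are distinct, so every component has at `O` exactly the pole of
`z` (`val_component`). But the component with `y^(n-1)` has its poles over a single point of the
line and therefore a pole of order at least `(n-1) e`. The genus bound gives `(n-1) e > n`, a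
contradiction. Hence θ fixes every `σ x`, and since `⟨θ⟩` is exactly the fixer of `x`, it is normal.

Let `S : (x, y) ↦ (ξ x, y)` with ξ a primitive `m`-th root of unity. It commutes with θ, and `⟨S⟩`
meets `⟨θ⟩` trivially. If the quotient is `C_m`, then `G = ⟨θ⟩ × ⟨S⟩`: cyclic when `m` and `n` are
coprime, the metacyclic group with `l = 1` otherwise. If the quotient is dihedral, a lifted
reflection acts as `x ↦ b/x`, `y ↦ κ y/x^e`, and `f(0) = 1` forces `κ^n = 1`. After multiplication
by a power of θ it commutes with θ and inverts `S` (`exists_dihedral_lift`). Its square is a power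
of θ. Either it can be changed to an involution, giving `D_{2m} × C_n`, or `n` is even and it can be
changed to a square root of θ, giving `G₂` or `G₄` according to the parity of `m`
(`mulEquiv_of_dihedral_quotient`). The other groups of the list are not needed. -/

/-! ### Places as valuation rings containing the constants. -/

section Places

variable {k F : Type*} [Field k] [Field F] [Algebra k F]

/-- A valuation subring of `F` that contains the constant field `k`. -/
def IsPlace (k : Type*) {F : Type*} [Field k] [Field F] [Algebra k F]
    (O : ValuationSubring F) : Prop :=
  ∀ c : k, algebraMap k F c ∈ O

namespace IsPlace

variable {O : ValuationSubring F}

theorem val_le_one (hO : IsPlace k O) (c : k) : O.valuation (algebraMap k F c) ≤ 1 :=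
  (O.valuation_le_one_iff _).2 (hO c)

theorem val_eq_one (hO : IsPlace k O) {c : k} (hc : c ≠ 0) :
    O.valuation (algebraMap k F c) = 1 := by
  refine le_antisymm (hO.val_le_one c) ?_
  have h := hO.val_le_one c⁻¹
  rw [map_inv₀, map_inv₀] at h
  have h0 : O.valuation (algebraMap k F c) ≠ 0 := by simpa using hc
  exact (inv_le_one₀ (zero_lt_iff.2 h0)).1 h

theorem comap (hO : IsPlace k O) (φ : F ≃ₐ[k] F) :
    IsPlace k (O.comap (φ : F →+* F)) := fun c => by
  simpa [ValuationSubring.mem_comap] using hO c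

theorem aeval_mem (hO : IsPlace k O) {x : F} (hx : x ∈ O) (p : k[X]) : aeval x p ∈ O := by
  induction p using Polynomial.induction_on' with
  | add p q hp hq => rw [map_add]; exact O.add_mem _ _ hp hq
  | monomial i c =>
    rw [aeval_monomial]
    exact O.mul_mem _ _ (hO c) (pow_mem hx i)

theorem mem_of_val_sub_lt_one (hO : IsPlace k O) {x : F} {c : k}
    (h : O.valuation (x - algebraMap k F c) < 1) : x ∈ O := by
  have h1 := O.add_mem _ _ ((O.valuation_le_one_iff _).1 h.le) (hO c)
  simpa using h1

/-- Modulo a multiple of `x - c`, which vanishes at the place, `p(x)` is the nonzero constant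
`p(c)`. -/
theorem val_aeval_eq_one (hO : IsPlace k O) {x : F} {c : k}
    (h : O.valuation (x - algebraMap k F c) < 1) {p : k[X]} (hp : p.eval c ≠ 0) :
    O.valuation (aeval x p) = 1 := by
  obtain ⟨q, hq⟩ : X - C c ∣ p - C (p.eval c) := by
    rw [dvd_iff_isRoot]; simp
  have e : aeval x p = algebraMap k F (p.eval c) + (x - algebraMap k F c) * aeval x q := by
    have := congrArg (aeval x) hq
    simp only [map_sub, map_mul, aeval_X, aeval_C] at this
    linear_combination this
  have h1 : O.valuation ((x - algebraMap k F c) * aeval x q) < 1 := by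
    rw [map_mul]
    exact mul_lt_one_of_lt_of_le h
      ((O.valuation_le_one_iff _).2 (hO.aeval_mem (hO.mem_of_val_sub_lt_one h) q))
  rw [e, Valuation.map_add_eq_of_lt_left, hO.val_eq_one hp]
  rwa [hO.val_eq_one hp]

theorem val_aeval_finite (hO : IsPlace k O) {x : F} {c : k}
    (h : O.valuation (x - algebraMap k F c) < 1) {p : k[X]} (hp : p ≠ 0) :
    O.valuation (aeval x p) = O.valuation (x - algebraMap k F c) ^ p.rootMultiplicity c := by
  obtain ⟨q, hq, hq'⟩ := exists_eq_pow_rootMultiplicity_mul_and_not_dvd p hp c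
  rw [dvd_iff_isRoot] at hq'
  have := congrArg (fun r => O.valuation (aeval x r)) hq
  simp only [map_mul, map_pow, map_sub, aeval_X, aeval_C] at this
  rw [this, hO.val_aeval_eq_one h hq', mul_one]

/-- Write `p(x)` as `x ^ deg p` times the reversed polynomial at `1/x`. The latter has nonzero
constant term, so it is a unit at a place where `1/x` vanishes. -/
theorem val_aeval_infinite (hO : IsPlace k O) {x : F} (h : 1 < O.valuation x) {p : k[X]}
    (hp : p ≠ 0) : O.valuation (aeval x p) = O.valuation x ^ p.natDegree := by
  have hx : x ≠ 0 := by rintro rfl; simp at h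
  have hinv : O.valuation (x⁻¹ - algebraMap k F 0) < 1 := by
    rw [map_zero, sub_zero, map_inv₀]; exact inv_lt_one_of_one_lt₀ h
  have h1 := hO.val_aeval_eq_one hinv (p := p.reverse) (by
    rw [← coeff_zero_eq_eval_zero, coeff_zero_reverse]; simpa using hp)
  let := invertibleOfNonzero hx
  have h2 := eval₂_reverse_mul_pow (algebraMap k F) x p
  rw [invOf_eq_inv, ← aeval_def, ← aeval_def] at h2
  rw [← h2, map_mul, h1, one_mul, map_pow]

/-- Chevalley's extension theorem: the ideal `(s)` of `k[s]` is proper because `s` is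
transcendental, so some valuation ring containing `k[s]` has it among its nonunits. -/
theorem exists_val_lt_one {s : F} (hs : Transcendental k s) :
    ∃ O : ValuationSubring F, IsPlace k O ∧ O.valuation s < 1 := by
  let A : Subalgebra k F := Algebra.adjoin k {s}
  have hsA : s ∈ A := Algebra.self_mem_adjoin_singleton k s
  let I : Ideal A.toSubring := Ideal.span {⟨s, hsA⟩}
  have hI : I ≠ ⊤ := by
    intro hI
    have h1 : (1 : A.toSubring) ∈ I := hI ▸ Submodule.mem_top
    obtain ⟨⟨b, hb⟩, hb1⟩ := Ideal.mem_span_singleton'.1 h1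
    have hb2 : b * s = 1 := congrArg Subtype.val hb1
    obtain ⟨p, hp⟩ : ∃ p : k[X], aeval s p = b := by
      have : b ∈ Algebra.adjoin k {s} := hb
      rwa [Algebra.adjoin_singleton_eq_range_aeval] at this
    refine hs ⟨p * X - 1, ?_, by simp [hp, hb2]⟩
    intro h0
    have := congrArg (eval 0) h0
    simp at this
  obtain ⟨O, hO, hO'⟩ := Ideal.image_subset_nonunits_valuationSubring I hI
  refine ⟨O, fun c => hO (A.algebraMap_mem c), ?_⟩
  rw [← ValuationSubring.mem_nonunits_iff]
  exact hO' ⟨⟨s, hsA⟩, Ideal.subset_span rfl, rfl⟩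

end IsPlace

end Places

/-! ### Local behaviour of the cyclic cover at its ramified places. -/

section Cover

variable {k F : Type*} [Field k] [Field F] [Algebra k F]

/-- The field `F` is the function field `k(x, y)` of the curve `y ^ n = f(x)`, where `f` is monic
and separable of degree `n * e`, and `θ` is the automorphism `(x, y) ↦ (x, ζ y)`. -/
structure IsCyclicCover (n e : ℕ) (f : k[X]) (ζ : k) (x y : F) (θ : F ≃ₐ[k] F) : Prop where
  two_le : 2 ≤ n
  cast_ne_zero : (n : k) ≠ 0
  two_le_e : 2 ≤ e
  genus : 2 < (n - 1) * e
  monic : f.Monic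
  natDegree_eq : f.natDegree = n * e
  separable : f.Separable
  isPrimitiveRoot : IsPrimitiveRoot ζ n
  transcendental : Transcendental k x
  pow_eq : y ^ n = aeval x f
  map_x : θ x = x
  map_y : θ y = algebraMap k F ζ * y
  exists_coeff : ∀ u : F, ∃ D : k[X], D ≠ 0 ∧ ∃ Q : ℕ → k[X],
    aeval x D * u = ∑ b ∈ Finset.range n, aeval x (Q b) * y ^ b

namespace IsCyclicCover

variable {n e : ℕ} {f : k[X]} {ζ : k} {x y : F} {θ : F ≃ₐ[k] F}

theorem map (h : IsCyclicCover n e f ζ x y θ) (σ : F ≃ₐ[k] F) :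
    IsCyclicCover n e f ζ (σ x) (σ y) ((σ.symm.trans θ).trans σ) where
  two_le := h.two_le
  cast_ne_zero := h.cast_ne_zero
  two_le_e := h.two_le_e
  genus := h.genus
  monic := h.monic
  natDegree_eq := h.natDegree_eq
  separable := h.separable
  isPrimitiveRoot := h.isPrimitiveRoot
  transcendental := fun ha => h.transcendental ((isAlgebraic_algHom_iff σ.toAlgHom
    σ.injective).1 ha)
  pow_eq := by rw [← map_pow, h.pow_eq, aeval_algHom_apply]
  map_x := by simp [h.map_x]
  map_y := by simp [h.map_y]
  exists_coeff := fun u => by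
    obtain ⟨D, hD, Q, hQ⟩ := h.exists_coeff (σ.symm u)
    refine ⟨D, hD, Q, ?_⟩
    have := congrArg σ hQ
    simpa [← aeval_algHom_apply] using this

theorem aeval_ne_zero (h : IsCyclicCover n e f ζ x y θ) {p : k[X]} (hp : p ≠ 0) :
    aeval x p ≠ 0 := fun h0 => h.transcendental ⟨p, hp, h0⟩

theorem y_ne_zero (h : IsCyclicCover n e f ζ x y θ) : y ≠ 0 := by
  rintro rfl
  have h1 := h.pow_eq
  rw [zero_pow (by have := h.two_le; omega)] at h1
  exact h.aeval_ne_zero h.monic.ne_zero h1.symm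

theorem x_sub_ne_zero (h : IsCyclicCover n e f ζ x y θ) (a : k) : x - algebraMap k F a ≠ 0 := by
  have := h.aeval_ne_zero (X_sub_C_ne_zero a)
  simpa using this

theorem x_ne_zero (h : IsCyclicCover n e f ζ x y θ) : x ≠ 0 := by
  simpa using h.x_sub_ne_zero 0

theorem rootMultiplicity_le_one (h : IsCyclicCover n e f ζ x y θ) (a : k) :
    f.rootMultiplicity a ≤ 1 := rootMultiplicity_le_one_of_separable h.separable a

theorem rootMultiplicity_eq_one (h : IsCyclicCover n e f ζ x y θ) {a : k} (ha : f.IsRoot a) :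
    f.rootMultiplicity a = 1 :=
  le_antisymm (h.rootMultiplicity_le_one a) ((rootMultiplicity_pos h.monic.ne_zero).2 ha)

variable {O : ValuationSubring F}

theorem val_y_pow_finite (h : IsCyclicCover n e f ζ x y θ) (hO : IsPlace k O) {c : k}
    (hc : O.valuation (x - algebraMap k F c) < 1) :
    O.valuation y ^ n = O.valuation (x - algebraMap k F c) ^ f.rootMultiplicity c := by
  rw [← map_pow, h.pow_eq, hO.val_aeval_finite hc h.monic.ne_zero]

theorem val_y_infinite (h : IsCyclicCover n e f ζ x y θ) (hO : IsPlace k O)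
    (hx : 1 < O.valuation x) : O.valuation y = O.valuation x ^ e := by
  have h1 : O.valuation y ^ n = (O.valuation x ^ e) ^ n := by
    rw [← map_pow, h.pow_eq, hO.val_aeval_infinite hx h.monic.ne_zero, h.natDegree_eq, ← pow_mul,
      mul_comm]
  exact (pow_left_inj₀ zero_le zero_le (by have := h.two_le; omega)).1 h1

theorem val_y_ramified (h : IsCyclicCover n e f ζ x y θ) (hO : IsPlace k O) {a : k}
    (ha : f.IsRoot a) (hc : O.valuation (x - algebraMap k F a) < 1) :
    O.valuation (x - algebraMap k F a) = O.valuation y ^ n := by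
  rw [h.val_y_pow_finite hO hc, h.rootMultiplicity_eq_one ha, pow_one]

theorem val_y_ramified_lt_one (h : IsCyclicCover n e f ζ x y θ) (hO : IsPlace k O) {a : k}
    (ha : f.IsRoot a) (hc : O.valuation (x - algebraMap k F a) < 1) :
    O.valuation y < 1 := by
  rw [h.val_y_ramified hO ha hc] at hc
  by_contra! hge
  exact absurd (one_le_pow₀ hge) hc.not_ge

theorem val_y_unramified (h : IsCyclicCover n e f ζ x y θ) (hO : IsPlace k O) {a : k}
    (ha : ¬ f.IsRoot a) (hc : O.valuation (x - algebraMap k F a) < 1) :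
    O.valuation y = 1 := by
  have h1 := h.val_y_pow_finite hO hc
  rw [rootMultiplicity_eq_zero ha, pow_zero] at h1
  exact (pow_eq_one_iff_of_nonneg zero_le (by have := h.two_le; omega)).1 h1

theorem val_term_ramified (h : IsCyclicCover n e f ζ x y θ) (hO : IsPlace k O) {a : k}
    (ha : f.IsRoot a) (hc : O.valuation (x - algebraMap k F a) < 1) {Q : k[X]} (hQ : Q ≠ 0)
    (b : ℕ) : O.valuation (aeval x Q * y ^ b) =
      O.valuation y ^ (n * Q.rootMultiplicity a + b) := by
  rw [map_mul, map_pow, hO.val_aeval_finite hc hQ, h.val_y_ramified hO ha hc, ← pow_mul, ← pow_add]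

/-- No cancellation can occur: the values of the nonzero terms are powers of `v(y)` whose exponents
are distinct modulo `n`, so the largest one is the value of the sum. -/
theorem val_sum_ramified (h : IsCyclicCover n e f ζ x y θ) (hO : IsPlace k O) {a : k}
    (ha : f.IsRoot a) (hc : O.valuation (x - algebraMap k F a) < 1) (Q : ℕ → k[X])
    (hQ : ∑ b ∈ Finset.range n, aeval x (Q b) * y ^ b ≠ 0) :
    (∃ b, Q b ≠ 0 ∧ O.valuation (∑ b ∈ Finset.range n, aeval x (Q b) * y ^ b) =
      O.valuation y ^ (n * (Q b).rootMultiplicity a + b)) ∧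
    ∀ b < n, O.valuation (aeval x (Q b) * y ^ b) ≤
      O.valuation (∑ b ∈ Finset.range n, aeval x (Q b) * y ^ b) := by
  have hn := h.two_le
  have hy1 := h.val_y_ramified_lt_one hO ha hc
  have hy0 : 0 < O.valuation y := zero_lt_iff.2 (by simpa using h.y_ne_zero)
  obtain ⟨b, hb, hmax⟩ := Finset.exists_max_image (Finset.range n)
    (fun b => O.valuation (aeval x (Q b) * y ^ b)) ⟨0, by simp; omega⟩
  have hQb : Q b ≠ 0 := by
    intro h0
    refine hQ (Finset.sum_eq_zero fun i hi => ?_)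
    have := hmax i hi
    rw [h0, map_zero, zero_mul, map_zero] at this
    exact (map_eq_zero O.valuation).1 (le_antisymm this zero_le)
  have hsum : O.valuation (∑ b ∈ Finset.range n, aeval x (Q b) * y ^ b) =
      O.valuation (aeval x (Q b) * y ^ b) := by
    refine Valuation.map_sum_eq_of_lt _ hb fun i hi => ?_
    rw [Finset.mem_sdiff, Finset.mem_singleton] at hi
    refine lt_of_le_of_ne (hmax i hi.1) fun heq => hi.2 ?_
    by_cases hQi : Q i = 0
    · rw [hQi, map_zero, zero_mul, map_zero, h.val_term_ramified hO ha hc hQb] at heq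
      exact absurd heq.symm (pow_ne_zero _ hy0.ne')
    · rw [h.val_term_ramified hO ha hc hQb, h.val_term_ramified hO ha hc hQi] at heq
      have := congrArg (· % n) (pow_right_injective₀ hy0 hy1.ne heq)
      simpa [Nat.mod_eq_of_lt (Finset.mem_range.1 hb), Nat.mod_eq_of_lt (Finset.mem_range.1 hi.1)]
        using this
  refine ⟨⟨b, hQb, by rw [hsum, h.val_term_ramified hO ha hc hQb]⟩, fun i hi => ?_⟩
  rw [hsum]; exact hmax i (Finset.mem_range.2 hi)

/-- In other words `y` is a uniformiser. This replaces any assumption that valuations are discrete.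
-/
theorem val_eq_zpow (h : IsCyclicCover n e f ζ x y θ) (hO : IsPlace k O) {a : k}
    (ha : f.IsRoot a) (hc : O.valuation (x - algebraMap k F a) < 1) {u : F} (hu : u ≠ 0) :
    ∃ i : ℤ, O.valuation u = O.valuation y ^ i := by
  obtain ⟨D, hD, Q, hQ⟩ := h.exists_coeff u
  have hy0 : O.valuation y ≠ 0 := by simpa using h.y_ne_zero
  obtain ⟨⟨b, -, hb⟩, -⟩ := h.val_sum_ramified hO ha hc Q
    (hQ ▸ mul_ne_zero (h.aeval_ne_zero hD) hu)
  have hD' := h.val_term_ramified hO ha hc hD 0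
  rw [pow_zero, mul_one, add_zero] at hD'
  rw [← hQ, map_mul, hD'] at hb
  refine ⟨((n * (Q b).rootMultiplicity a + b : ℕ) : ℤ) - (n * D.rootMultiplicity a : ℕ), ?_⟩
  rw [zpow_sub₀ hy0, zpow_natCast, zpow_natCast, eq_div_iff (pow_ne_zero _ hy0), mul_comm]
  exact hb

/-- Total ramification leaves one place over `a`: without cancellation, integrality of `u` is a set
of inequalities between exponents that do not depend on the place. -/
theorem le_of_ramified (h : IsCyclicCover n e f ζ x y θ) {O' : ValuationSubring F}
    (hO : IsPlace k O) (hO' : IsPlace k O') {a : k} (ha : f.IsRoot a)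
    (hc : O.valuation (x - algebraMap k F a) < 1)
    (hc' : O'.valuation (x - algebraMap k F a) < 1) : O ≤ O' := by
  intro u hu
  by_cases hu0 : u = 0
  · rw [hu0]; exact O'.zero_mem
  have hy1 := h.val_y_ramified_lt_one hO ha hc
  have hy0 : 0 < O.valuation y := zero_lt_iff.2 (by simpa using h.y_ne_zero)
  have hy1' := h.val_y_ramified_lt_one hO' ha hc'
  obtain ⟨D, hD, Q, hQ⟩ := h.exists_coeff u
  obtain ⟨-, hmax⟩ := h.val_sum_ramified hO ha hc Q
    (hQ ▸ mul_ne_zero (h.aeval_ne_zero hD) hu0)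
  have hval : ∀ {O : ValuationSubring F}, IsPlace k O →
      O.valuation (x - algebraMap k F a) < 1 → O.valuation (aeval x D) =
      O.valuation y ^ (n * D.rootMultiplicity a) := fun hO hc => by
    simpa using h.val_term_ramified hO ha hc hD 0
  have hle : O'.valuation (aeval x D * u) ≤ O'.valuation (aeval x D) := by
    rw [hQ]
    refine Valuation.map_sum_le _ fun b hb => ?_
    by_cases hQb : Q b = 0
    · simp [hQb]
    rw [h.val_term_ramified hO' ha hc' hQb, hval hO' hc']
    refine pow_le_pow_of_le_one zero_le hy1'.le ?_
    have h1 := hmax b (Finset.mem_range.1 hb)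
    rw [← hQ, h.val_term_ramified hO ha hc hQb, map_mul, hval hO hc] at h1
    exact (pow_le_pow_iff_right_of_lt_one₀ hy0 hy1).1
      (h1.trans (mul_le_of_le_one_right' ((O.valuation_le_one_iff u).2 hu)))
  rw [map_mul] at hle
  rw [← O'.valuation_le_one_iff]
  exact (mul_le_iff_le_one_right (zero_lt_iff.2 (by simpa using h.aeval_ne_zero hD))).1 hle

theorem eq_of_ramified (h : IsCyclicCover n e f ζ x y θ) {O' : ValuationSubring F}
    (hO : IsPlace k O) (hO' : IsPlace k O') {a : k} (ha : f.IsRoot a)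
    (hc : O.valuation (x - algebraMap k F a) < 1)
    (hc' : O'.valuation (x - algebraMap k F a) < 1) : O = O' :=
  le_antisymm (h.le_of_ramified hO hO' ha hc hc') (h.le_of_ramified hO' hO ha hc' hc)

end IsCyclicCover

end Cover

/-! ### Residues over an algebraically closed field. -/

section Places

variable {k F : Type*} [Field k] [Field F] [Algebra k F]

theorem ValuationSubring.comap_val_lt_one_iff (O : ValuationSubring F) (φ : F ≃ₐ[k] F) (u : F) :
    (O.comap (φ : F →+* F)).valuation u < 1 ↔ O.valuation (φ u) < 1 := by
  rw [← ValuationSubring.mem_nonunits_iff, ← ValuationSubring.mem_nonunits_iff,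
    ValuationSubring.mem_nonunits_iff_or, ValuationSubring.mem_nonunits_iff_or,
    ValuationSubring.mem_comap]
  simp

theorem Polynomial.dvd_of_rootMultiplicity_le [IsAlgClosed k] {p q : k[X]} (hp : p ≠ 0)
    (hq : q ≠ 0) (h : ∀ c, p.rootMultiplicity c ≤ q.rootMultiplicity c) : p ∣ q := by
  classical
  rw [(IsAlgClosed.splits p).dvd_iff_roots_le_roots hp hq, Multiset.le_iff_count]
  simpa using h

theorem IsPlace.exists_val_sub_lt_one [IsAlgClosed k] {O : ValuationSubring F} (hO : IsPlace k O)
    {x : F} (hx : x ∈ O) {p : k[X]} (hp : O.valuation (aeval x p) < 1) (hp0 : p ≠ 0) :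
    ∃ c : k, O.valuation (x - algebraMap k F c) < 1 := by
  by_contra! hcon
  have h1 : ∀ c : k, O.valuation (x - algebraMap k F c) = 1 := fun c =>
    le_antisymm ((O.valuation_le_one_iff _).2 (sub_mem hx (hO c))) (hcon c)
  rw [(IsAlgClosed.splits p).eq_prod_roots, map_mul, aeval_C, map_mul,
    hO.val_eq_one (leadingCoeff_ne_zero.2 hp0), one_mul, map_multiset_prod, map_multiset_prod,
    Multiset.map_map, Multiset.map_map] at hp
  refine hp.ne (Multiset.prod_eq_one fun r hr => ?_)
  obtain ⟨c, -, rfl⟩ := Multiset.mem_map.1 hr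
  simpa using h1 c

end Places

/-! ### Eigencomponents under θ and bounds on their poles. -/

namespace IsCyclicCover

variable {k F : Type*} [Field k] [Field F] [Algebra k F]
variable {n e : ℕ} {f : k[X]} {ζ : k} {x y : F} {θ : F ≃ₐ[k] F}

theorem exists_place_finite (h : IsCyclicCover n e f ζ x y θ) (c : k) :
    ∃ O : ValuationSubring F, IsPlace k O ∧ O.valuation (x - algebraMap k F c) < 1 := by
  refine IsPlace.exists_val_lt_one fun ha => h.transcendental ?_
  have := ha.add (isAlgebraic_algebraMap (A := F) c)
  simpa using this

theorem exists_place_infinite (h : IsCyclicCover n e f ζ x y θ) :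
    ∃ O : ValuationSubring F, IsPlace k O ∧ 1 < O.valuation x := by
  obtain ⟨O, hO, h1⟩ := IsPlace.exists_val_lt_one (k := k) (s := x⁻¹)
    fun ha => h.transcendental (by simpa using ha.inv)
  rw [map_inv₀] at h1
  exact ⟨O, hO, (inv_lt_one₀ (zero_lt_iff.2 (by simpa using h.x_ne_zero))).1 h1⟩

/-- The valuation ring must be proper because `IsPlace` admits the whole field. As `y` is integral
over `k[x]`, an element outside `O` can only come from a denominator `D(x)` that vanishes at `O`,
and then `x` reduces to a root of `D`. -/
theorem exists_val_sub_lt_one [IsAlgClosed k] (h : IsCyclicCover n e f ζ x y θ)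
    {O : ValuationSubring F} (hO : IsPlace k O) (hx : x ∈ O) (hne : ∃ u, u ∉ O) :
    ∃ c : k, O.valuation (x - algebraMap k F c) < 1 := by
  obtain ⟨u, hu⟩ := hne
  obtain ⟨D, hD, Q, hQ⟩ := h.exists_coeff u
  refine hO.exists_val_sub_lt_one hx (p := D) ?_ hD
  by_contra! hge
  refine hu ((O.valuation_le_one_iff u).1 ?_)
  have hD1 : O.valuation (aeval x D) = 1 :=
    le_antisymm ((O.valuation_le_one_iff _).2 (hO.aeval_mem hx D)) hge
  have hy : O.valuation y ≤ 1 := by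
    by_contra! hy
    have h1 : 1 < O.valuation (y ^ n) := by
      rw [map_pow]; exact one_lt_pow₀ hy (by have := h.two_le; omega)
    rw [h.pow_eq] at h1
    exact h1.not_ge ((O.valuation_le_one_iff _).2 (hO.aeval_mem hx f))
  have := congrArg O.valuation hQ
  rw [map_mul, hD1, one_mul] at this
  rw [this]
  refine Valuation.map_sum_le _ fun b _ => ?_
  rw [map_mul, map_pow]
  exact mul_le_one' ((O.valuation_le_one_iff _).2 (hO.aeval_mem hx _)) (pow_le_one₀ zero_le hy)

theorem map_pow_y (h : IsCyclicCover n e f ζ x y θ) (i : ℕ) :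
    (θ ^ i) y = algebraMap k F (ζ ^ i) * y := by
  induction i with
  | zero => simp
  | succ i ih =>
    rw [pow_succ, AlgEquiv.mul_apply, h.map_y, map_mul, ih, AlgEquiv.commutes, pow_succ, map_mul]
    ring

theorem map_pow_x (h : IsCyclicCover n e f ζ x y θ) (i : ℕ) : (θ ^ i) x = x := by
  induction i with
  | zero => simp
  | succ i ih => rw [pow_succ, AlgEquiv.mul_apply, h.map_x, ih]

theorem map_pow_aeval (h : IsCyclicCover n e f ζ x y θ) (i : ℕ) (p : k[X]) :
    (θ ^ i) (aeval x p) = aeval x p := by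
  rw [← aeval_algHom_apply, h.map_pow_x]

/-- Lagrange resolvents: summing the conjugates of `u` against the powers of `ζ^(-b)` isolates the
`ζ^b`-eigencomponent, the other terms dying as geometric sums over nontrivial roots of unity. -/
theorem sum_conjugates (h : IsCyclicCover n e f ζ x y θ) {u : F} {D : k[X]} {Q : ℕ → k[X]}
    (hQ : aeval x D * u = ∑ b ∈ Finset.range n, aeval x (Q b) * y ^ b) {b : ℕ} (hb : b < n) :
    algebraMap k F n * (aeval x (Q b) * y ^ b) =
      aeval x D * ∑ i ∈ Finset.range n, algebraMap k F ((ζ ^ b)⁻¹ ^ i) * (θ ^ i) u := by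
  have hζ := h.isPrimitiveRoot
  have hζ0 : ζ ≠ 0 := hζ.ne_zero (by have := h.two_le; omega)
  have h1 : ∀ i, aeval x D * (algebraMap k F ((ζ ^ b)⁻¹ ^ i) * (θ ^ i) u) =
      ∑ j ∈ Finset.range n, algebraMap k F ((ζ ^ j * (ζ ^ b)⁻¹) ^ i) * (aeval x (Q j) * y ^ j) := by
    intro i
    have h2 := congrArg (θ ^ i) hQ
    rw [map_mul, h.map_pow_aeval, map_sum] at h2
    rw [mul_left_comm, h2, Finset.mul_sum]
    refine Finset.sum_congr rfl fun j _ => ?_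
    have h3 : (θ ^ i) (y ^ j) = algebraMap k F ((ζ ^ j) ^ i) * y ^ j := by
      rw [map_pow (θ ^ i), h.map_pow_y, mul_pow, ← map_pow, pow_right_comm]
    rw [map_mul (θ ^ i), h.map_pow_aeval, h3, mul_pow, map_mul]
    ring
  rw [Finset.mul_sum, Finset.sum_congr rfl fun i _ => h1 i, Finset.sum_comm,
    Finset.sum_eq_single_of_mem b (Finset.mem_range.2 hb)]
  · rw [mul_inv_cancel₀ (pow_ne_zero _ hζ0)]; simp
  · intro j hj hjb
    rw [← Finset.sum_mul, ← map_sum]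
    have hr : ζ ^ j * (ζ ^ b)⁻¹ ≠ 1 := fun hr => hjb (hζ.pow_inj (Finset.mem_range.1 hj) hb
      (by rwa [mul_inv_eq_one₀ (pow_ne_zero _ hζ0)] at hr))
    have hg := geom_sum_mul (ζ ^ j * (ζ ^ b)⁻¹) n
    rw [mul_pow, ← pow_mul, inv_pow, ← pow_mul, mul_comm j, mul_comm b, pow_mul, pow_mul,
      hζ.pow_eq_one, one_pow, one_pow, inv_one, mul_one, sub_self] at hg
    rw [(mul_eq_zero.1 hg).resolve_right (sub_ne_zero.2 hr), map_zero, zero_mul]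

theorem component_eq (h : IsCyclicCover n e f ζ x y θ) {u : F} {D : k[X]} (hD : D ≠ 0)
    {Q : ℕ → k[X]} (hQ : aeval x D * u = ∑ b ∈ Finset.range n, aeval x (Q b) * y ^ b) {b : ℕ}
    (hb : b < n) : aeval x (Q b) * y ^ b / aeval x D =
      algebraMap k F (n : k)⁻¹ *
        ∑ i ∈ Finset.range n, algebraMap k F ((ζ ^ b)⁻¹ ^ i) * (θ ^ i) u := by
  have h1 := h.sum_conjugates hQ hb
  have h2 := h.aeval_ne_zero hD
  have h3 : algebraMap k F (n : k) ≠ 0 :=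
    (_root_.map_ne_zero _).2 h.cast_ne_zero
  rw [map_inv₀, eq_inv_mul_iff_mul_eq₀ h3, ← mul_div_assoc, h1, mul_div_cancel_left₀ _ h2]

theorem component_mem (h : IsCyclicCover n e f ζ x y θ) {O : ValuationSubring F}
    (hO : IsPlace k O) {u : F} (hu : ∀ i, (θ ^ i) u ∈ O) {D : k[X]} (hD : D ≠ 0)
    {Q : ℕ → k[X]} (hQ : aeval x D * u = ∑ b ∈ Finset.range n, aeval x (Q b) * y ^ b) {b : ℕ}
    (hb : b < n) : aeval x (Q b) * y ^ b / aeval x D ∈ O := by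
  rw [h.component_eq hD hQ hb]
  exact O.mul_mem _ _ (hO _) (sum_mem fun i _ => O.mul_mem _ _ (hO _) (hu i))

/-- After taking `n`-th powers, `y^b` contributes at most `b < n` zeros in `x - c`, too few to
cancel one full extra zero of `D`. -/
theorem rootMultiplicity_le_of_mem (h : IsCyclicCover n e f ζ x y θ) {O : ValuationSubring F}
    (hO : IsPlace k O) {c : k} (hc : O.valuation (x - algebraMap k F c) < 1) {D Q : k[X]}
    (hD : D ≠ 0) (hQ : Q ≠ 0) {b : ℕ} (hb : b < n) (hw : aeval x Q * y ^ b / aeval x D ∈ O) :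
    D.rootMultiplicity c ≤ Q.rootMultiplicity c := by
  have ht0 : 0 < O.valuation (x - algebraMap k F c) :=
    zero_lt_iff.2 (by simpa using h.x_sub_ne_zero c)
  have hD0 : 0 < O.valuation (aeval x D) := zero_lt_iff.2 (by simpa using h.aeval_ne_zero hD)
  have h1 := (O.valuation_le_one_iff _).2 hw
  rw [map_div₀, div_le_one₀ hD0] at h1
  have h2 := pow_le_pow_left₀ zero_le h1 n
  rw [map_mul, mul_pow, map_pow, ← pow_mul, mul_comm b, pow_mul, h.val_y_pow_finite hO hc,
    hO.val_aeval_finite hc hQ, hO.val_aeval_finite hc hD, ← pow_mul, ← pow_mul, ← pow_mul,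
    ← pow_add, pow_le_pow_iff_right_of_lt_one₀ ht0 hc] at h2
  have h3 := h.rootMultiplicity_le_one c
  by_contra! h4
  nlinarith

theorem natDegree_add_le_of_mem (h : IsCyclicCover n e f ζ x y θ) {O : ValuationSubring F}
    (hO : IsPlace k O) (hx : 1 < O.valuation x) {D Q : k[X]}
    (hD : D ≠ 0) (hQ : Q ≠ 0) {b : ℕ} (hw : aeval x Q * y ^ b / aeval x D ∈ O) :
    Q.natDegree + b * e ≤ D.natDegree := by
  have hD0 : 0 < O.valuation (aeval x D) := zero_lt_iff.2 (by simpa using h.aeval_ne_zero hD)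
  have h1 := (O.valuation_le_one_iff _).2 hw
  rw [map_div₀, div_le_one₀ hD0, map_mul, map_pow, h.val_y_infinite hO hx,
    hO.val_aeval_infinite hx hQ, hO.val_aeval_infinite hx hD, ← pow_mul, ← pow_add,
    pow_le_pow_iff_right₀ hx] at h1
  rwa [mul_comm b]

/-- The divisibility says that `D` divides `Q` away from `a`, written without division. The
inequality is regularity at infinity, where `y` grows like `x^e`. -/
theorem poles_finite [IsAlgClosed k] (h : IsCyclicCover n e f ζ x y θ) {a : k} {D Q : k[X]}
    (hD : D ≠ 0) (hQ : Q ≠ 0) {b : ℕ} (hb : b < n)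
    (hw : ∀ O : ValuationSubring F, IsPlace k O → ¬ O.valuation (x - algebraMap k F a) < 1 →
      aeval x Q * y ^ b / aeval x D ∈ O) :
    D * (X - C a) ^ Q.rootMultiplicity a ∣ Q * (X - C a) ^ D.rootMultiplicity a ∧
      Q.natDegree + b * e ≤ D.natDegree := by
  constructor
  · have hXa : ∀ i, (X - C a) ^ i ≠ 0 := fun i => pow_ne_zero _ (X_sub_C_ne_zero a)
    refine Polynomial.dvd_of_rootMultiplicity_le (mul_ne_zero hD (hXa _)) (mul_ne_zero hQ (hXa _))
      fun c => ?_
    rw [rootMultiplicity_mul (mul_ne_zero hD (hXa _)), rootMultiplicity_mul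
      (mul_ne_zero hQ (hXa _))]
    by_cases hca : c = a
    · subst hca
      rw [rootMultiplicity_X_sub_C_pow, rootMultiplicity_X_sub_C_pow, add_comm]
    · have h0 : ∀ i, rootMultiplicity c ((X - C a) ^ i) = 0 := fun i => by
        refine rootMultiplicity_eq_zero ?_
        simp only [IsRoot, eval_pow, eval_sub, eval_X, eval_C]
        exact pow_ne_zero _ (sub_ne_zero.2 hca)
      rw [h0, h0, add_zero, add_zero]
      obtain ⟨O, hO, hc⟩ := h.exists_place_finite c
      refine h.rootMultiplicity_le_of_mem hO hc hD hQ hb (hw O hO fun hac => ?_)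
      have h1 := O.valuation.map_sub_lt hac hc
      rw [sub_sub_sub_cancel_left, ← map_sub, hO.val_eq_one (sub_ne_zero.2 hca)] at h1
      exact lt_irrefl _ h1
  · obtain ⟨O, hO, hx⟩ := h.exists_place_infinite
    refine h.natDegree_add_le_of_mem hO hx hD hQ (hw O hO fun hac => ?_)
    exact hx.not_ge ((O.valuation_le_one_iff _).2 (hO.mem_of_val_sub_lt_one hac))

theorem poles_infinite [IsAlgClosed k] (h : IsCyclicCover n e f ζ x y θ) {D Q : k[X]}
    (hD : D ≠ 0) (hQ : Q ≠ 0) {b : ℕ} (hb : b < n)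
    (hw : ∀ O : ValuationSubring F, IsPlace k O → O.valuation x ≤ 1 →
      aeval x Q * y ^ b / aeval x D ∈ O) : D.natDegree ≤ Q.natDegree := by
  refine natDegree_le_of_dvd (Polynomial.dvd_of_rootMultiplicity_le hD hQ fun c => ?_) hQ
  obtain ⟨O, hO, hc⟩ := h.exists_place_finite c
  exact h.rootMultiplicity_le_of_mem hO hc hD hQ hb
    (hw O hO ((O.valuation_le_one_iff _).2 (hO.mem_of_val_sub_lt_one hc)))

theorem natDegree_le_of_poles_finite [IsAlgClosed k] (h : IsCyclicCover n e f ζ x y θ) {a : k}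
    {D Q : k[X]} (hD : D ≠ 0) (hQ : Q ≠ 0) {b : ℕ} (hb : b < n)
    (hw : ∀ O : ValuationSubring F, IsPlace k O → ¬ O.valuation (x - algebraMap k F a) < 1 →
      aeval x Q * y ^ b / aeval x D ∈ O) :
    Q.rootMultiplicity a + b * e ≤ D.rootMultiplicity a := by
  obtain ⟨h1, h2⟩ := h.poles_finite hD hQ hb hw
  have hXa : ∀ i, (X - C a) ^ i ≠ 0 := fun i => pow_ne_zero _ (X_sub_C_ne_zero a)
  have h3 := natDegree_le_of_dvd h1 (mul_ne_zero hQ (hXa _))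
  rw [natDegree_mul hD (hXa _), natDegree_mul hQ (hXa _), natDegree_pow, natDegree_pow,
    natDegree_X_sub_C] at h3
  omega

end IsCyclicCover

/-! ### Two covering structures differ by a Möbius transformation. -/

namespace IsCyclicCover

variable {k F : Type*} [Field k] [Field F] [Algebra k F]
variable {n e : ℕ} {f : k[X]} {ζ : k} {x y : F} {θ : F ≃ₐ[k] F}

/-- A function whose only pole is the `n`-fold ramified place over the root `a` of `f`
is a function of `x`. -/
theorem exists_linear_of_ramified [IsAlgClosed k] (h : IsCyclicCover n e f ζ x y θ)
    {O : ValuationSubring F} (hO : IsPlace k O) {a : k} (ha : f.IsRoot a)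
    (hc : O.valuation (x - algebraMap k F a) < 1) {z : F}
    (hz : ∀ O' : ValuationSubring F, IsPlace k O' → O' ≠ O → z ∈ O')
    (hval : O.valuation z * O.valuation y ^ n = 1) :
    ∃ α β : k, (x - algebraMap k F a) * z = algebraMap k F α * x + algebraMap k F β := by
  have hn := h.two_le
  have he := h.two_le_e
  have hy1 := h.val_y_ramified_lt_one hO ha hc
  have hy0 : 0 < O.valuation y := zero_lt_iff.2 (by simpa using h.y_ne_zero)
  have hz0 : z ≠ 0 := by rintro rfl; simp at hval
  obtain ⟨D, hD, Q, hQ⟩ := h.exists_coeff z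
  have hDv : O.valuation (aeval x D) = O.valuation y ^ (n * D.rootMultiplicity a) := by
    simpa using h.val_term_ramified hO ha hc hD 0
  have hmem : ∀ b < n, ∀ O' : ValuationSubring F, IsPlace k O' →
      ¬ O'.valuation (x - algebraMap k F a) < 1 → aeval x (Q b) * y ^ b / aeval x D ∈ O' := by
    intro b hb O' hO' hnot
    refine h.component_mem hO' (fun i => ?_) hD hQ hb
    have h1 := hz (O'.comap ((θ ^ i : F ≃ₐ[k] F) : F →+* F)) (hO'.comap _) (by
      rintro rfl
      rw [ValuationSubring.comap_val_lt_one_iff, map_sub, h.map_pow_x, AlgEquiv.commutes] at hc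
      exact hnot hc)
    rwa [ValuationSubring.mem_comap] at h1
  obtain ⟨-, hmax⟩ := h.val_sum_ramified hO ha hc Q
    (hQ ▸ mul_ne_zero (h.aeval_ne_zero hD) hz0)
  -- Such a component would have at `O` a pole of order at least `n b e - b`, which exceeds the
  -- order `n` of the pole of `z` because `e ≥ 2`.
  have hzero : ∀ b < n, b ≠ 0 → Q b = 0 := by
    intro b hb hb0
    by_contra hQb
    have h1 := h.natDegree_le_of_poles_finite hD hQb hb (hmem b hb)
    have h2 := hmax b hb
    rw [← hQ, h.val_term_ramified hO ha hc hQb, map_mul, hDv] at h2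
    have h3 := mul_le_mul_left h2 (O.valuation y ^ n)
    rw [mul_assoc, hval, mul_one, ← pow_add, pow_le_pow_iff_right_of_lt_one₀ hy0 hy1] at h3
    have h4 : n * ((Q b).rootMultiplicity a + b * e) ≤ n * ((Q b).rootMultiplicity a) + b + n :=
      (Nat.mul_le_mul_left n h1).trans h3
    have h5 : n * (b * 2) ≤ n * (b * e) := by gcongr
    have h6 : 1 ≤ b := Nat.one_le_iff_ne_zero.2 hb0
    nlinarith
  have hsum : aeval x D * z = aeval x (Q 0) := by
    rw [hQ, Finset.sum_eq_single_of_mem 0 (Finset.mem_range.2 (by omega))]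
    · simp
    · intro b hb hb0
      rw [hzero b (Finset.mem_range.1 hb) hb0, map_zero, zero_mul]
  have hQ0 : Q 0 ≠ 0 := by
    intro h0
    rw [h0, map_zero] at hsum
    exact mul_ne_zero (h.aeval_ne_zero hD) hz0 hsum
  obtain ⟨hdvd, hdeg⟩ := h.poles_finite hD hQ0 (by omega : 0 < n) (hmem 0 (by omega))
  -- A pole of order `n` at `O` is a simple pole in the coordinate `x - a`.
  have hmult : D.rootMultiplicity a = (Q 0).rootMultiplicity a + 1 := by
    have h1 := congrArg O.valuation hsum
    have h2 : O.valuation (aeval x (Q 0)) = O.valuation y ^ (n * (Q 0).rootMultiplicity a) := by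
      simpa using h.val_term_ramified hO ha hc hQ0 0
    rw [map_mul, hDv, h2] at h1
    have h3 := congrArg (· * O.valuation y ^ n) h1
    simp only [mul_assoc, hval, mul_one] at h3
    rw [← pow_add] at h3
    have h4 := pow_right_injective₀ hy0 hy1.ne h3
    have h5 : n * D.rootMultiplicity a = n * ((Q 0).rootMultiplicity a + 1) := by
      rw [mul_add, mul_one]; exact h4
    exact Nat.eq_of_mul_eq_mul_left (by omega) h5
  rw [hmult, pow_succ, mul_comm _ (X - C a), ← mul_assoc] at hdvd
  obtain ⟨L, hL⟩ := (mul_dvd_mul_iff_right (pow_ne_zero _ (X_sub_C_ne_zero a))).1 hdvd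
  have hLdeg : L.natDegree ≤ 1 := by
    have hL0 : L ≠ 0 := by
      rintro rfl
      rw [mul_zero] at hL
      exact mul_ne_zero hQ0 (X_sub_C_ne_zero a) hL
    have := congrArg natDegree hL
    rw [natDegree_mul hQ0 (X_sub_C_ne_zero a), natDegree_mul hD hL0, natDegree_X_sub_C] at this
    omega
  obtain ⟨α, β, rfl⟩ := exists_eq_X_add_C_of_natDegree_le_one hLdeg
  refine ⟨α, β, ?_⟩
  have h1 := congrArg (aeval x) hL
  simp only [map_mul, map_sub, map_add, aeval_X, aeval_C, ← hsum] at h1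
  apply mul_left_cancel₀ (h.aeval_ne_zero hD)
  linear_combination h1

/-- At `O` the eigenfunction `u` takes a nonzero value `d`. If the place were stable under `θ^i`,
then `ζ^i d = d`, which is impossible for `0 < i < n`. -/
theorem comap_pow_ne [IsAlgClosed k] (h : IsCyclicCover n e f ζ x y θ)
    {O : ValuationSubring F} (hO : IsPlace k O) {u : F} (hu : θ u = algebraMap k F ζ * u) {c : k}
    (hc : c ≠ 0) (huc : O.valuation (u ^ n - algebraMap k F c) < 1) {i : ℕ} (hi0 : i ≠ 0)
    (hi : i < n) : O.comap ((θ ^ i : F ≃ₐ[k] F) : F →+* F) ≠ O := by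
  intro heq
  have hn := h.two_le
  have hζ := h.isPrimitiveRoot
  have hpu : ∀ i : ℕ, (θ ^ i) u = algebraMap k F (ζ ^ i) * u := fun i => by
    induction i with
    | zero => simp
    | succ i ih =>
      rw [pow_succ, AlgEquiv.mul_apply, hu, map_mul, ih, AlgEquiv.commutes, pow_succ, map_mul]
      ring
  have hun : u ^ n ∈ O := hO.mem_of_val_sub_lt_one huc
  have huO : u ∈ O := by
    rw [← O.valuation_le_one_iff] at hun ⊢
    rw [map_pow] at hun
    exact (pow_le_one_iff_of_nonneg zero_le (by omega)).1 hun
  obtain ⟨d, hd⟩ := hO.exists_val_sub_lt_one huO (p := X ^ n - C c) (by simpa using huc)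
    (X_pow_sub_C_ne_zero (by omega) c)
  have hd0 : d ≠ 0 := by
    rintro rfl
    rw [map_zero, sub_zero] at hd
    have h1 : O.valuation (u ^ n) < 1 := by
      rw [map_pow]; exact pow_lt_one₀ zero_le hd (by omega)
    have h2 := O.valuation.map_sub_lt h1 huc
    rw [sub_sub_cancel, hO.val_eq_one hc] at h2
    exact lt_irrefl _ h2
  have h1 := hd
  rw [← heq, ValuationSubring.comap_val_lt_one_iff, map_sub, AlgEquiv.commutes, hpu] at h1
  have h2 : O.valuation (algebraMap k F (ζ ^ i) * (u - algebraMap k F d)) < 1 := by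
    rwa [map_mul, hO.val_eq_one (pow_ne_zero _ (hζ.ne_zero (by omega))), one_mul]
  have h3 := O.valuation.map_sub_lt h1 h2
  have h4 : algebraMap k F (ζ ^ i) * u - algebraMap k F d -
      algebraMap k F (ζ ^ i) * (u - algebraMap k F d) = algebraMap k F ((ζ ^ i - 1) * d) := by
    rw [map_mul, map_sub, map_one]; ring
  rw [h4, hO.val_eq_one (mul_ne_zero (sub_ne_zero.2 (hζ.pow_ne_one_of_pos_of_lt hi0 hi)) hd0)]
    at h3
  exact lt_irrefl _ h3

/-- In the resolvent for the component only the term `i = 0` has a pole at `O`: the other conjugates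
of `z` have theirs at places different from `O`. -/
theorem val_component [IsAlgClosed k] (h : IsCyclicCover n e f ζ x y θ)
    {O : ValuationSubring F} (hO : IsPlace k O) {u : F} (hu : θ u = algebraMap k F ζ * u) {c : k}
    (hc : c ≠ 0) (huc : O.valuation (u ^ n - algebraMap k F c) < 1) {z : F}
    (hz : ∀ O' : ValuationSubring F, IsPlace k O' → O' ≠ O → z ∈ O') (hz1 : 1 < O.valuation z)
    {D : k[X]} (hD : D ≠ 0) {Q : ℕ → k[X]}
    (hQ : aeval x D * z = ∑ b ∈ Finset.range n, aeval x (Q b) * y ^ b) {b : ℕ} (hb : b < n) :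
    O.valuation (aeval x (Q b) * y ^ b / aeval x D) = O.valuation z := by
  classical
  have hn := h.two_le
  rw [h.component_eq hD hQ hb, map_mul, hO.val_eq_one (inv_ne_zero h.cast_ne_zero), one_mul,
    Valuation.map_sum_eq_of_lt (j := 0) _ (Finset.mem_range.2 (by omega))]
  · simp
  · intro i hi
    rw [Finset.mem_sdiff, Finset.mem_range, Finset.mem_singleton] at hi
    have h1 := hz _ (hO.comap (θ ^ i)) (h.comap_pow_ne hO hu hc huc hi.2 hi.1)
    rw [ValuationSubring.mem_comap] at h1
    have h2 := (O.valuation_le_one_iff _).2 (O.mul_mem _ _ (hO ((ζ ^ b)⁻¹ ^ i)) h1)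
    refine lt_of_le_of_lt h2 ?_
    simpa using hz1

theorem n_lt (h : IsCyclicCover n e f ζ x y θ) : n < (n - 1) * e := by
  have hn := h.two_le
  have he := h.two_le_e
  have hg := h.genus
  obtain ⟨r, rfl⟩ : ∃ r, n = r + 1 := ⟨n - 1, by omega⟩
  rw [Nat.add_sub_cancel] at hg ⊢
  rcases Nat.lt_or_ge r 2 with hr | hr
  · omega
  · nlinarith

/-- Here `p` stands for the value of a uniformiser and `t` for that of the coordinate `x - a` or
`1/x`. The pole of `z` has order `n` by `hzp` but at least `(n-1) e` by `hzt`. -/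
theorem false_of_pole_le [IsAlgClosed k] (h : IsCyclicCover n e f ζ x y θ)
    {O : ValuationSubring F} {z : F} {p t : O.ValueGroup} (hp1 : p < 1)
    (hzp : O.valuation z * p ^ n = 1) (htp : t ≤ p)
    (hzt : 1 ≤ O.valuation z * t ^ ((n - 1) * e)) : False := by
  have hp0 : 0 < p := zero_lt_iff.2 (by
    rintro rfl
    rw [zero_pow (by have := h.two_le; omega), mul_zero] at hzp
    exact zero_ne_one hzp)
  have hz0 : 0 < O.valuation z := zero_lt_iff.2 (by rintro h0; rw [h0, zero_mul] at hzp; simp at hzp)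
  have h1 : O.valuation z * p ^ n ≤ O.valuation z * p ^ ((n - 1) * e) := by
    rw [hzp]
    exact hzt.trans (mul_le_mul_right (pow_le_pow_left₀ zero_le htp _) _)
  have h2 := le_of_mul_le_mul_left h1 hz0
  rw [pow_le_pow_iff_right_of_lt_one₀ hp0 hp1] at h2
  exact h2.not_gt h.n_lt

theorem unramified_finite_absurd [IsAlgClosed k] (h : IsCyclicCover n e f ζ x y θ)
    {O : ValuationSubring F} (hO : IsPlace k O) {a : k} (ha : ¬ f.IsRoot a)
    (hc : O.valuation (x - algebraMap k F a) < 1) {z : F}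
    (hz : ∀ O' : ValuationSubring F, IsPlace k O' → O' ≠ O → z ∈ O') (hz1 : 1 < O.valuation z)
    {p : O.ValueGroup} (hp1 : p < 1) (hzp : O.valuation z * p ^ n = 1)
    (htp : O.valuation (x - algebraMap k F a) ≤ p) : False := by
  have hn := h.two_le
  obtain ⟨D, hD, Q, hQ⟩ := h.exists_coeff z
  have hfa : O.valuation (y ^ n - algebraMap k F (f.eval a)) < 1 := by
    have h1 : y ^ n - algebraMap k F (f.eval a) = aeval x (f - C (f.eval a)) := by
      rw [map_sub, aeval_C, h.pow_eq]
    obtain ⟨q, hq⟩ : X - C a ∣ f - C (f.eval a) := by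
      rw [dvd_iff_isRoot]; simp
    rw [h1, hq, map_mul, map_mul]
    refine mul_lt_one_of_lt_of_le (by simpa using hc)
      ((O.valuation_le_one_iff _).2 (hO.aeval_mem (hO.mem_of_val_sub_lt_one hc) q))
  -- The top component is used because the forced pole order `b e` is largest there.
  have hv := h.val_component hO h.map_y ha hfa hz hz1 hD hQ (b := n - 1) (by omega)
  have ht0 : 0 < O.valuation (x - algebraMap k F a) :=
    zero_lt_iff.2 (by simpa using h.x_sub_ne_zero a)
  have hQ0 : Q (n - 1) ≠ 0 := by
    intro h0
    rw [h0, map_zero, zero_mul, zero_div, map_zero] at hv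
    rw [← hv] at hz1
    exact not_lt_zero hz1
  have h1 := h.natDegree_le_of_poles_finite hD hQ0 (b := n - 1) (by omega) (a := a)
    fun O' hO' hnot => h.component_mem hO' (fun i => by
      have h1 := hz (O'.comap ((θ ^ i : F ≃ₐ[k] F) : F →+* F)) (hO'.comap _) (by
        rintro rfl
        rw [ValuationSubring.comap_val_lt_one_iff, map_sub, h.map_pow_x, AlgEquiv.commutes] at hc
        exact hnot hc)
      rwa [ValuationSubring.mem_comap] at h1) hD hQ (by omega)
  refine h.false_of_pole_le hp1 hzp htp ?_
  rw [map_div₀, map_mul, map_pow, h.val_y_unramified hO ha hc, one_pow, mul_one,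
    hO.val_aeval_finite hc hQ0, hO.val_aeval_finite hc hD] at hv
  rw [← hv, div_mul_eq_mul_div, ← pow_add, one_le_div₀ (pow_pos ht0 _),
    pow_le_pow_iff_right_of_lt_one₀ ht0 hc]
  exact h1

/-- Infinity is unramified since `n` divides `deg f`: the function `y / x^e` takes over the role of
`y`, its `n`-th power having value `1` there because `f` is monic. -/
theorem infinite_absurd [IsAlgClosed k] (h : IsCyclicCover n e f ζ x y θ)
    {O : ValuationSubring F} (hO : IsPlace k O) (hx : 1 < O.valuation x) {z : F}
    (hz : ∀ O' : ValuationSubring F, IsPlace k O' → O' ≠ O → z ∈ O') (hz1 : 1 < O.valuation z)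
    {p : O.ValueGroup} (hp1 : p < 1) (hzp : O.valuation z * p ^ n = 1)
    (htp : (O.valuation x)⁻¹ ≤ p) : False := by
  have hn := h.two_le
  have hx0 := h.x_ne_zero
  obtain ⟨D, hD, Q, hQ⟩ := h.exists_coeff z
  have hfa : O.valuation ((y / x ^ e) ^ n - algebraMap k F 1) < 1 := by
    have h1 : (y / x ^ e) ^ n - algebraMap k F 1 = aeval x (f - X ^ (n * e)) / x ^ (n * e) := by
      rw [map_sub, aeval_X_pow, div_pow, h.pow_eq, map_one, ← pow_mul, mul_comm e]
      field_simp
    rw [h1, map_div₀, div_lt_one₀ (by rw [map_pow]; exact pow_pos (zero_lt_one.trans hx) _)]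
    by_cases h0 : f - X ^ (n * e) = 0
    · rw [h0, map_zero, map_zero, map_pow]
      exact pow_pos (zero_lt_one.trans hx) _
    · rw [hO.val_aeval_infinite hx h0, map_pow, pow_lt_pow_iff_right₀ hx]
      have hne : n * e ≠ 0 := by have := h.two_le_e; positivity
      have h2 := degree_sub_lt_left (p := f) (q := X ^ (n * e)) (by
        rw [degree_eq_natDegree h.monic.ne_zero, h.natDegree_eq, degree_X_pow]) h.monic.ne_zero
        (by rw [h.monic.leadingCoeff, leadingCoeff_X_pow])
      have h3 := natDegree_lt_natDegree h0 h2
      rwa [h.natDegree_eq] at h3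
  have hv := h.val_component hO (u := y / x ^ e) (by
    rw [map_div₀, map_pow, h.map_x, h.map_y, mul_div_assoc]) one_ne_zero hfa hz hz1 hD hQ
    (b := n - 1) (by omega)
  have hQ0 : Q (n - 1) ≠ 0 := by
    intro h0
    rw [h0, map_zero, zero_mul, zero_div, map_zero] at hv
    rw [← hv] at hz1
    exact not_lt_zero hz1
  have h1 := h.poles_infinite hD hQ0 (b := n - 1) (by omega)
    fun O' hO' hle => h.component_mem hO' (fun i => by
      have h1 := hz (O'.comap ((θ ^ i : F ≃ₐ[k] F) : F →+* F)) (hO'.comap _) (by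
        rintro rfl
        have h2 := (O'.valuation_le_one_iff _).1 hle
        rw [← not_le, ValuationSubring.valuation_le_one_iff, ValuationSubring.mem_comap] at hx
        apply hx
        simpa [h.map_pow_x] using h2)
      rwa [ValuationSubring.mem_comap] at h1) hD hQ (by omega)
  refine h.false_of_pole_le hp1 hzp htp ?_
  have hx0' : 0 < O.valuation x := zero_lt_one.trans hx
  rw [map_div₀, map_mul, map_pow, h.val_y_infinite hO hx,
    hO.val_aeval_infinite hx hQ0, hO.val_aeval_infinite hx hD] at hv
  rw [← hv, inv_pow, ← div_eq_mul_inv, mul_comm (n - 1) e, pow_mul, one_le_div₀ (pow_pos (pow_pos hx0' _) _),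
    le_div_iff₀ (pow_pos hx0' _), mul_comm]
  gcongr
  exact hx.le

/-- The coordinates of any two cyclic covering structures of the same type on `F` differ by
a Möbius transformation. -/
theorem exists_mobius [IsAlgClosed k] (h : IsCyclicCover n e f ζ x y θ) {x' y' : F}
    {θ' : F ≃ₐ[k] F} (h' : IsCyclicCover n e f ζ x' y' θ') :
    ∃ a a' α β : k, (x' - algebraMap k F a') * (algebraMap k F α * x + algebraMap k F β) =
      x - algebraMap k F a := by
  have hn := h.two_le
  obtain ⟨a', ha'⟩ : ∃ a', f.IsRoot a' := IsAlgClosed.exists_root f (by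
    rw [degree_eq_natDegree h.monic.ne_zero, h.natDegree_eq]
    have := h.two_le_e
    exact_mod_cast (by positivity : n * e ≠ 0))
  obtain ⟨O, hO, hc'⟩ := h'.exists_place_finite a'
  have hs0 := h'.x_sub_ne_zero a'
  have hp1 := h'.val_y_ramified_lt_one hO ha' hc'
  have hp0 : 0 < O.valuation y' := zero_lt_iff.2 (by simpa using h'.y_ne_zero)
  -- A pole of `1/(x' - a')` lies over `x' = a'`, where `O` is the only place.
  have hz : ∀ O' : ValuationSubring F, IsPlace k O' → O' ≠ O →
      (x' - algebraMap k F a')⁻¹ ∈ O' := by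
    intro O' hO' hne
    by_contra hmem
    refine hne (h'.eq_of_ramified hO' hO ha' ?_ hc')
    rw [← ValuationSubring.mem_nonunits_iff, ValuationSubring.mem_nonunits_iff_or]
    exact Or.inr hmem
  have hzp : O.valuation (x' - algebraMap k F a')⁻¹ * O.valuation y' ^ n = 1 := by
    rw [map_inv₀, h'.val_y_ramified hO ha' hc']
    exact inv_mul_cancel₀ (pow_ne_zero _ hp0.ne')
  have hz1 : 1 < O.valuation (x' - algebraMap k F a')⁻¹ := by
    rw [map_inv₀]
    exact (one_lt_inv₀ (zero_lt_iff.2 (by simpa using hs0))).2 hc'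
  have hmin : ∀ u : F, u ≠ 0 → O.valuation u < 1 → O.valuation u ≤ O.valuation y' := by
    intro u hu0 hu
    obtain ⟨i, hi⟩ := h'.val_eq_zpow hO ha' hc' hu0
    rw [hi] at hu ⊢
    have h1 : 0 < i := by
      by_contra! h0
      exact hu.not_ge (one_le_zpow_of_nonpos₀ hp0 hp1.le h0)
    calc O.valuation y' ^ i ≤ O.valuation y' ^ (1 : ℤ) :=
          zpow_le_zpow_right_of_le_one₀ hp0 hp1.le h1
      _ = O.valuation y' := zpow_one _
  by_cases hx : x ∈ O
  · obtain ⟨a, ha⟩ := h.exists_val_sub_lt_one hO hx ⟨(x' - algebraMap k F a')⁻¹, by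
      rw [← O.valuation_le_one_iff]; exact hz1.not_ge⟩
    by_cases hroot : f.IsRoot a
    · have hy1 := h.val_y_ramified_lt_one hO hroot ha
      have hy0 : 0 < O.valuation y := zero_lt_iff.2 (by simpa using h.y_ne_zero)
      -- Both `y` and `y'` are uniformisers at `O`, so their values agree.
      have hyy : O.valuation y = O.valuation y' := by
        refine le_antisymm (hmin y h.y_ne_zero hy1) ?_
        obtain ⟨i, hi⟩ := h.val_eq_zpow hO hroot ha h'.y_ne_zero
        rw [hi] at hp1 ⊢
        have h1 : 0 < i := by
          by_contra! h0
          exact hp1.not_ge (one_le_zpow_of_nonpos₀ hy0 hy1.le h0)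
        calc O.valuation y ^ i ≤ O.valuation y ^ (1 : ℤ) :=
              zpow_le_zpow_right_of_le_one₀ hy0 hy1.le h1
          _ = O.valuation y := zpow_one _
      obtain ⟨α, β, hL⟩ := h.exists_linear_of_ramified hO hroot ha hz (by rw [hyy]; exact hzp)
      refine ⟨a, a', α, β, ?_⟩
      rw [← hL]
      field_simp
    · exact (h.unramified_finite_absurd hO hroot ha hz hz1 hp1 hzp
        (hmin _ (h.x_sub_ne_zero a) ha)).elim
  · have hx1 : 1 < O.valuation x := by
      rw [← O.valuation_le_one_iff] at hx; exact not_le.1 hx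
    refine (h.infinite_absurd hO hx1 hz hz1 hp1 hzp ?_).elim
    rw [← map_inv₀]
    exact hmin _ (inv_ne_zero h.x_ne_zero) (by rw [map_inv₀]; exact inv_lt_one_of_one_lt₀ hx1)

end IsCyclicCover

/-! ### Normality of `⟨θ⟩` and the action of a lifted reflection on `x`. -/

namespace IsCyclicCover

variable {k F : Type*} [Field k] [Field F] [Algebra k F]
variable {n e : ℕ} {f : k[X]} {ζ : k} {x y : F} {θ : F ≃ₐ[k] F}

theorem map_map_x [IsAlgClosed k] (h : IsCyclicCover n e f ζ x y θ) (σ : F ≃ₐ[k] F) :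
    θ (σ x) = σ x := by
  obtain ⟨a, a', α, β, hσ⟩ := h.exists_mobius (h.map σ)
  have hL : algebraMap k F α * x + algebraMap k F β ≠ 0 := by
    intro h0
    rw [h0, mul_zero] at hσ
    exact h.x_sub_ne_zero a hσ.symm
  have h1 := congrArg θ hσ
  simp only [map_mul, map_sub, map_add, AlgEquiv.commutes, h.map_x] at h1
  rw [← hσ] at h1
  have h2 := mul_right_cancel₀ hL h1
  exact sub_left_injective h2

theorem algHom_ext (h : IsCyclicCover n e f ζ x y θ) {φ ψ : F →ₐ[k] F} (hx : φ x = ψ x)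
    (hy : φ y = ψ y) : φ = ψ := by
  ext u
  obtain ⟨D, hD, Q, hQ⟩ := h.exists_coeff u
  have hpoly : ∀ p : k[X], φ (aeval x p) = ψ (aeval x p) := fun p => by
    rw [← aeval_algHom_apply, ← aeval_algHom_apply, hx]
  have h1 : φ (aeval x D) * φ u = φ (aeval x D) * ψ u := by
    rw [← map_mul, hQ, hpoly, ← map_mul ψ, hQ, map_sum, map_sum]
    refine Finset.sum_congr rfl fun b _ => ?_
    rw [map_mul, map_mul, hpoly, map_pow, map_pow, hy]
  exact mul_left_cancel₀ ((_root_.map_ne_zero φ).2 (h.aeval_ne_zero hD)) h1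

theorem algEquiv_ext (h : IsCyclicCover n e f ζ x y θ) {φ ψ : F ≃ₐ[k] F} (hx : φ x = ψ x)
    (hy : φ y = ψ y) : φ = ψ :=
  AlgEquiv.coe_toAlgHom_injective (h.algHom_ext (φ := φ) (ψ := ψ) hx hy)

theorem pow_n (h : IsCyclicCover n e f ζ x y θ) : θ ^ n = 1 := by
  refine h.algEquiv_ext (by simp [h.map_pow_x]) ?_
  rw [h.map_pow_y, h.isPrimitiveRoot.pow_eq_one]; simp

theorem orderOf_eq (h : IsCyclicCover n e f ζ x y θ) : orderOf θ = n := by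
  rw [orderOf_eq_iff (by have := h.two_le; omega)]
  refine ⟨h.pow_n, fun i hi hi0 h1 => ?_⟩
  have h2 := h.map_pow_y i
  rw [h1, AlgEquiv.one_apply, eq_comm, mul_eq_right₀ h.y_ne_zero] at h2
  exact h.isPrimitiveRoot.pow_ne_one_of_pos_of_lt hi0.ne' hi
    ((algebraMap k F).injective (by rw [h2, map_one]))

/-- Kummer theory: if φ fixes `x`, then `φ y / y` is an `n`-th root of unity, that is, a power of ζ.
-/
theorem mem_zpowers_iff (h : IsCyclicCover n e f ζ x y θ) {φ : F ≃ₐ[k] F} :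
    φ ∈ Subgroup.zpowers θ ↔ φ x = x := by
  constructor
  · rintro ⟨i, rfl⟩
    have h1 : θ ∈ MulAction.stabilizer (F ≃ₐ[k] F) x := h.map_x
    exact zpow_mem h1 i
  · intro hx
    have hn := h.two_le
    have : NeZero n := ⟨by omega⟩
    have h1 : (φ y / y) ^ n = 1 := by
      rw [div_pow, ← map_pow, h.pow_eq, ← aeval_algHom_apply, hx, div_self]
      exact h.aeval_ne_zero h.monic.ne_zero
    have hζ : IsPrimitiveRoot (algebraMap k F ζ) n :=
      h.isPrimitiveRoot.map_of_injective (algebraMap k F).injective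
    obtain ⟨i, -, hi⟩ := hζ.eq_pow_of_pow_eq_one h1
    have h2 : θ ^ i = φ := h.algEquiv_ext (by rw [hx, h.map_pow_x]) ?_
    · rw [← h2]; exact Subgroup.npow_mem_zpowers θ i
    rw [h.map_pow_y, map_pow, hi, div_mul_cancel₀ _ h.y_ne_zero]

theorem normal_zpowers [IsAlgClosed k] (h : IsCyclicCover n e f ζ x y θ) :
    (Subgroup.zpowers θ).Normal := by
  refine ⟨fun φ hφ σ => ?_⟩
  rw [h.mem_zpowers_iff, AlgEquiv.mul_apply, AlgEquiv.mul_apply]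
  have h1 : φ (σ⁻¹ x) = σ⁻¹ x := by
    have h2 : θ ∈ MulAction.stabilizer (F ≃ₐ[k] F) (σ⁻¹ x) := h.map_map_x σ⁻¹
    exact (Subgroup.zpowers_le.2 h2) hφ
  rw [h1, ← AlgEquiv.mul_apply, mul_inv_cancel, AlgEquiv.one_apply]

theorem map_map_x_of_mem [IsAlgClosed k] (h : IsCyclicCover n e f ζ x y θ) {φ : F ≃ₐ[k] F}
    (hφ : φ ∈ Subgroup.zpowers θ) (σ : F ≃ₐ[k] F) : φ (σ x) = σ x := by
  have h2 : θ ∈ MulAction.stabilizer (F ≃ₐ[k] F) (σ x) := h.map_map_x σ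
  exact (Subgroup.zpowers_le.2 h2) hφ

/-- The fixed field of θ is `k(x)`, since a fixed element equals its component with `b = 0`. The
fraction is reduced so that its denominator can later be bounded. -/
theorem exists_fraction_of_fixed (h : IsCyclicCover n e f ζ x y θ) {w : F} (hw : θ w = w) :
    ∃ D N : k[X], D ≠ 0 ∧ IsCoprime D N ∧ aeval x D * w = aeval x N := by
  classical
  have hn := h.two_le
  obtain ⟨D, hD, Q, hQ⟩ := h.exists_coeff w
  have h1 := h.sum_conjugates hQ (b := 0) (by omega)
  have hpow : ∀ i : ℕ, (θ ^ i) w = w := fun i => by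
    have h2 : θ ∈ MulAction.stabilizer (F ≃ₐ[k] F) w := hw
    exact pow_mem h2 i
  simp only [hpow, pow_zero, inv_one, one_pow, map_one, one_mul, mul_one, Finset.sum_const,
    Finset.card_range, nsmul_eq_mul, map_natCast] at h1
  have h3 : (n : F) ≠ 0 := by
    rw [← map_natCast (algebraMap k F)]
    exact (_root_.map_ne_zero _).2 h.cast_ne_zero
  have h2 : aeval x D * w = aeval x (Q 0) := mul_left_cancel₀ h3 (by rw [h1]; ring)
  have hg : EuclideanDomain.gcd D (Q 0) ≠ 0 := fun h0 =>
    hD (EuclideanDomain.gcd_eq_zero_iff.1 h0).1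
  have hab := EuclideanDomain.gcd_eq_gcd_ab D (Q 0)
  obtain ⟨D', hD'⟩ := EuclideanDomain.gcd_dvd_left D (Q 0)
  obtain ⟨N', hN'⟩ := EuclideanDomain.gcd_dvd_right D (Q 0)
  generalize EuclideanDomain.gcd D (Q 0) = g at *
  generalize EuclideanDomain.gcdA D (Q 0) = A at *
  generalize EuclideanDomain.gcdB D (Q 0) = B at *
  refine ⟨D', N', ?_, ⟨A, B, mul_left_cancel₀ hg ?_⟩, mul_left_cancel₀ (h.aeval_ne_zero hg) ?_⟩
  · rintro rfl
    exact hD (by rw [hD', mul_zero])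
  · linear_combination -hab - A * hD' - B * hN'
  · rw [← mul_assoc, ← map_mul, ← map_mul, ← hD', ← hN', h2]

theorem aeval_injective (h : IsCyclicCover n e f ζ x y θ) {p q : k[X]}
    (hpq : aeval x p = aeval x q) : p = q := transcendental_iff_injective.1 h.transcendental hpq

theorem quadratic_eq_zero (h : IsCyclicCover n e f ζ x y θ) {a b c : k}
    (habc : algebraMap k F a * x ^ 2 + algebraMap k F b * x + algebraMap k F c = 0) :
    a = 0 ∧ b = 0 ∧ c = 0 := by
  have h1 : C a * X ^ 2 + C b * X + C c = (0 : k[X]) := h.aeval_injective (by simpa using habc)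
  refine ⟨?_, ?_, ?_⟩
  · have := congrArg (coeff · 2) h1
    simpa [coeff_X, coeff_C] using this
  · have := congrArg (coeff · 1) h1
    simpa [coeff_X, coeff_C, coeff_X_pow] using this
  · have := congrArg (coeff · 0) h1
    simpa [coeff_X, coeff_C, coeff_X_pow] using this

/-- An automorphism that inverts `x ↦ ξ x` modulo `⟨θ⟩`, is an involution modulo `⟨θ⟩` and is
not a power of `x ↦ ξ x` modulo `⟨θ⟩`, acts on `x` by `x ↦ b / x`. -/
theorem exists_map_x_eq_div [IsAlgClosed k] (h : IsCyclicCover n e f ζ x y θ) {ξ : k} (hξ : ξ ≠ 1)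
    (hξ0 : ξ ≠ 0) {S T : F ≃ₐ[k] F} (hSx : S x = algebraMap k F ξ * x)
    (hTT : T * T ∈ Subgroup.zpowers θ) (hST : S * T * S * T⁻¹ ∈ Subgroup.zpowers θ)
    (hT : ∀ i : ℕ, T * S ^ i ∉ Subgroup.zpowers θ) :
    ∃ b : k, b ≠ 0 ∧ T x = algebraMap k F b / x := by
  have hx0 := h.x_ne_zero
  have hT2 : T (T x) = x := h.mem_zpowers_iff.1 hTT
  obtain ⟨a, a', α, β, hM⟩ := h.exists_mobius (h.map T)
  set γ := 1 + a' * α with hγ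
  set δ := a' * β - a with hδ
  have hM2 : T x * (algebraMap k F α * x + algebraMap k F β) =
      algebraMap k F γ * x + algebraMap k F δ := by
    simp only [hγ, hδ, map_add, map_sub, map_mul, map_one]
    linear_combination hM
  -- A degenerate transformation would make `T x` constant.
  have hdet : γ * β - δ * α ≠ 0 := by
    intro h0
    have h1 : β = -(a * α) := by linear_combination h0
    rw [h1] at hM
    have h2 : (T x - algebraMap k F a') * algebraMap k F α = 1 := by
      apply mul_right_cancel₀ (h.x_sub_ne_zero a)
      rw [map_neg, map_mul] at hM
      linear_combination hM
    have h3 : α ≠ 0 := by rintro rfl; simp at h2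
    apply (h.map T).x_sub_ne_zero (a' + α⁻¹)
    have h4 : algebraMap k F α ≠ 0 := by simpa using h3
    apply mul_right_cancel₀ h4
    rw [zero_mul, map_add, map_inv₀, ← sub_sub, sub_mul, h2, inv_mul_cancel₀ h4, sub_self]
  have hSTx : algebraMap k F ξ * S (T x) = T x := by
    have h1 := h.map_map_x_of_mem hST T
    simp only [AlgEquiv.mul_apply] at h1
    rw [← AlgEquiv.mul_apply T⁻¹ T, inv_mul_cancel, AlgEquiv.one_apply, hSx, map_mul, map_mul,
      AlgEquiv.commutes, AlgEquiv.commutes] at h1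
    exact h1
  have hS := congrArg S hM2
  simp only [map_mul, map_add, AlgEquiv.commutes, hSx] at hS
  -- With `M(x) = T x`, the relation `ξ M(ξ x) = M(x)` is cleared of denominators and its
  -- coefficients are compared.
  obtain ⟨h1, h2, h3⟩ := h.quadratic_eq_zero (a := γ * α * ξ * (1 - ξ))
    (b := γ * β * (1 - ξ ^ 2)) (c := δ * β * (1 - ξ)) (by
      simp only [map_mul, map_sub, map_one, map_pow]
      linear_combination (-(algebraMap k F α * (algebraMap k F ξ * x) + algebraMap k F β)) * hM2
        + (algebraMap k F ξ * (algebraMap k F α * x + algebraMap k F β)) * hS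
        + (-(algebraMap k F α * x + algebraMap k F β) *
          (algebraMap k F α * (algebraMap k F ξ * x) + algebraMap k F β)) * hSTx)
  have hξ1 : 1 - ξ ≠ 0 := sub_ne_zero.2 hξ.symm
  have h1' : γ * α = 0 := by simpa [hξ0, hξ1] using h1
  have h3' : δ * β = 0 := by simpa [hξ1] using h3
  by_cases hγ0 : γ = 0
  · rw [hγ0, zero_mul, zero_sub, neg_ne_zero] at hdet
    obtain ⟨hδ0, hα0⟩ := mul_ne_zero_iff.1 hdet
    have hβ0 : β = 0 := (mul_eq_zero.1 h3').resolve_left hδ0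
    rw [hγ0, hβ0, map_zero, add_zero, zero_mul, zero_add] at hM2
    refine ⟨δ / α, div_ne_zero hδ0 hα0, ?_⟩
    have : algebraMap k F α ≠ 0 := by simpa using hα0
    rw [map_div₀]
    field_simp
    linear_combination hM2
  -- The remaining solution is `ξ = -1` with `T x = ± x`, and then `T` or `T S` lies in `⟨θ⟩`, which
  -- `hT` excludes.
  · exfalso
    have hα0 : α = 0 := (mul_eq_zero.1 h1').resolve_left hγ0
    rw [hα0, mul_zero, sub_zero] at hdet
    have hβ0 : β ≠ 0 := (mul_ne_zero_iff.1 hdet).2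
    have hδ0 : δ = 0 := (mul_eq_zero.1 h3').resolve_right hβ0
    have hξ2 : ξ ^ 2 = 1 := by
      have := (mul_eq_zero.1 h2).resolve_left hdet
      linear_combination -this
    have hξm : ξ = -1 := (sq_eq_one_iff.1 hξ2).resolve_left hξ
    have hβF : algebraMap k F β ≠ 0 := by simpa using hβ0
    have hTx : T x = algebraMap k F (γ / β) * x := by
      rw [hα0, hδ0, map_zero, zero_mul, zero_add, add_zero] at hM2
      rw [map_div₀]
      field_simp
      linear_combination hM2
    have hμ : (γ / β) ^ 2 = 1 := by
      rw [hTx, map_mul, AlgEquiv.commutes, hTx, ← mul_assoc, mul_eq_right₀ hx0, ← map_mul] at hT2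
      rw [sq]
      exact (algebraMap k F).injective (by rw [hT2, map_one])
    rcases sq_eq_one_iff.1 hμ with h0 | h0
    · refine hT 0 (h.mem_zpowers_iff.2 ?_)
      rw [pow_zero, mul_one, hTx, h0, map_one, one_mul]
    · refine hT 1 (h.mem_zpowers_iff.2 ?_)
      rw [pow_one, AlgEquiv.mul_apply, hSx, map_mul, AlgEquiv.commutes, hTx, h0, hξm]
      simp

end IsCyclicCover

/-! ### The action on `y` and normalisation of the lifted reflection. -/

namespace IsCyclicCover

variable {k F : Type*} [Field k] [Field F] [Algebra k F]
variable {n e : ℕ} {f : k[X]} {ζ : k} {x y : F} {θ : F ≃ₐ[k] F}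

theorem exists_pow_of_mem_zpowers (h : IsCyclicCover n e f ζ x y θ) {φ : F ≃ₐ[k] F}
    (hφ : φ ∈ Subgroup.zpowers θ) : ∃ i < n, θ ^ i = φ := by
  classical
  have hn := h.two_le
  have hfin : IsOfFinOrder θ := isOfFinOrder_iff_pow_eq_one.2 ⟨n, by omega, h.pow_n⟩
  rw [← hfin.mem_powers_iff_mem_zpowers, hfin.mem_powers_iff_mem_range_orderOf, h.orderOf_eq] at hφ
  simpa using hφ

/-- An automorphism acting as `x ↦ b / x` maps `y` to a constant multiple of `y / x ^ e`. -/
theorem exists_map_y_eq [IsAlgClosed k] (h : IsCyclicCover n e f ζ x y θ) {T : F ≃ₐ[k] F} {b : k}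
    (hb : b ≠ 0) (hTx : T x = algebraMap k F b / x) :
    ∃ κ : k, κ ≠ 0 ∧ κ ^ n * f.coeff 0 = b ^ (n * e) ∧ T y = algebraMap k F κ * y / x ^ e := by
  have hn := h.two_le
  have he := h.two_le_e
  have hx0 := h.x_ne_zero
  have hy0 := h.y_ne_zero
  have hconj : T⁻¹ * θ * T ∈ Subgroup.zpowers θ := by
    have := h.normal_zpowers.conj_mem θ (Subgroup.mem_zpowers θ) T⁻¹
    rwa [inv_inv] at this
  obtain ⟨j, hj, hjT⟩ := h.exists_pow_of_mem_zpowers hconj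
  have hTj : θ * T = T * θ ^ j := by rw [hjT]; group
  have hθTy : θ (T y) = algebraMap k F (ζ ^ j) * T y := by
    have := congrArg (fun φ : F ≃ₐ[k] F => φ y) hTj
    simp only [AlgEquiv.mul_apply] at this
    rw [this, h.map_pow_y, map_mul, AlgEquiv.commutes]
  have hζF : algebraMap k F (ζ ^ j) ≠ 0 :=
    (_root_.map_ne_zero _).2 (pow_ne_zero _ (h.isPrimitiveRoot.ne_zero (by omega)))
  -- `T y` and `y^j` have the same θ-eigenvalue, so their quotient is a rational function of `x`.
  -- The factor `x^e` clears the denominators of `f(b/x)`.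
  obtain ⟨D, N, hD, hcop, hDN⟩ := h.exists_fraction_of_fixed (w := T y * x ^ e / y ^ j) (by
    rw [map_div₀, map_mul, map_pow, map_pow, h.map_x, h.map_y, hθTy, mul_pow, ← map_pow]
    field_simp)
  have hTy0 : T y ≠ 0 := (map_ne_zero_iff T T.injective).2 hy0
  have hN : N ≠ 0 := by
    rintro rfl
    rw [map_zero] at hDN
    exact mul_ne_zero (h.aeval_ne_zero hD)
      (div_ne_zero (mul_ne_zero hTy0 (pow_ne_zero _ hx0)) (pow_ne_zero _ hy0)) hDN
  have hTyn : (T y) ^ n = aeval (algebraMap k F b / x) f := by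
    rw [← map_pow, h.pow_eq, ← aeval_algHom_apply, hTx]
  set g := f.comp (C b * X) with hg
  have hgdeg : g.natDegree = n * e := by
    rw [hg, natDegree_comp, natDegree_C_mul_X _ hb, mul_one, h.natDegree_eq]
  have hrev : aeval x g.reverse = aeval (algebraMap k F b / x) f * x ^ (n * e) := by
    let := invertibleOfNonzero (inv_ne_zero hx0)
    have h2 := eval₂_reverse_mul_pow (algebraMap k F) x⁻¹ g
    rw [invOf_eq_inv, inv_inv, ← aeval_def, ← aeval_def, hgdeg, hg, aeval_comp, map_mul, aeval_C,
      aeval_X, ← div_eq_mul_inv] at h2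
    rw [← h2, inv_pow, mul_assoc, inv_mul_cancel₀ (pow_ne_zero _ hx0), mul_one]
  have hDN' : aeval x D * (T y * x ^ e) = aeval x N * y ^ j := by
    rw [← hDN]; field_simp
  have hpoly : D ^ n * g.reverse = N ^ n * f ^ j := by
    apply h.aeval_injective
    have h1 := congrArg (· ^ n) hDN'
    simp only [mul_pow] at h1
    rw [hTyn, ← pow_mul, mul_comm e n, ← hrev, ← pow_mul, mul_comm j n, pow_mul y, h.pow_eq] at h1
    simpa only [map_mul, map_pow] using h1
  -- A root of `D` would be a root of `f^j` of multiplicity at least `n`, but `f` has simple roots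
  -- and `j < n`.
  have hDdeg : D.natDegree = 0 := by
    by_contra hne
    obtain ⟨c, hc⟩ := IsAlgClosed.exists_root D (by
      rw [degree_eq_natDegree hD]; exact_mod_cast hne)
    have h1 : (X - C c) ^ n ∣ f ^ j := by
      refine dvd_trans (pow_dvd_pow_of_dvd (dvd_iff_isRoot.2 hc) n) ?_
      exact (hcop.pow (m := n) (n := n)).dvd_of_dvd_mul_left ⟨_, hpoly.symm⟩
    rw [← le_rootMultiplicity_iff (pow_ne_zero _ h.monic.ne_zero)] at h1
    have h2 := h.rootMultiplicity_le_one c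
    have h3 : rootMultiplicity c (f ^ j) = j * rootMultiplicity c f := by
      classical
      rw [← count_roots, ← count_roots, roots_pow, Multiset.count_nsmul]
    rw [h3] at h1
    nlinarith
  obtain ⟨d, rfl⟩ := natDegree_eq_zero.1 hDdeg
  have hd : d ≠ 0 := by rintro rfl; simp at hD
  have hdeg : n * N.natDegree + j * (n * e) ≤ n * e := by
    have h1 := congrArg natDegree hpoly
    rw [natDegree_mul (pow_ne_zero _ hN) (pow_ne_zero _ h.monic.ne_zero), natDegree_pow,
      natDegree_pow, h.natDegree_eq, ← C_pow, natDegree_C_mul (pow_ne_zero _ hd)] at h1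
    rw [← h1, ← hgdeg]
    exact reverse_natDegree_le g
  have hne : 0 < n * e := by positivity
  -- The degree bound gives `j ≤ 1`, and `j = 0` would make θ trivial. So `T` commutes with θ.
  have hj1 : j = 1 := by
    have h1 : j ≠ 0 := by
      rintro rfl
      rw [pow_zero, mul_one, mul_eq_right] at hTj
      have := h.orderOf_eq
      rw [hTj, orderOf_one] at this
      omega
    have h2 : j < 2 := by nlinarith
    omega
  subst hj1
  have hNdeg : N.natDegree = 0 := by
    have : n * N.natDegree = 0 := by omega
    simpa [show n ≠ 0 by omega] using this
  obtain ⟨ν, rfl⟩ := natDegree_eq_zero.1 hNdeg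
  have hν : ν ≠ 0 := by rintro rfl; simp at hN
  have hdF : algebraMap k F d ≠ 0 := (_root_.map_ne_zero _).2 hd
  refine ⟨ν / d, div_ne_zero hν hd, ?_, ?_⟩
  · have h1 := congrArg (coeff · 0) hpoly
    simp only [← C_pow, coeff_C_mul, pow_one, coeff_zero_reverse] at h1
    have h2 : g.leadingCoeff = b ^ (n * e) := by
      rw [hg, leadingCoeff_comp (by rw [natDegree_C_mul_X _ hb]; exact one_ne_zero),
        h.monic.leadingCoeff, h.natDegree_eq]
      simp
    rw [h2] at h1
    rw [div_pow, div_mul_eq_mul_div, ← h1, mul_div_cancel_left₀ _ (pow_ne_zero _ hd)]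
  · rw [aeval_C, aeval_C, pow_one] at hDN'
    rw [map_div₀]
    field_simp
    linear_combination hDN'

/-- The lift of a dihedral involution can be normalised to `(x, y) ↦ (b / x, y / x ^ e)`. -/
theorem exists_dihedral_lift [IsAlgClosed k] (h : IsCyclicCover n e f ζ x y θ)
    (hf0 : f.coeff 0 = 1) {ξ : k} (hξ : ξ ≠ 1) (hξe : ξ ^ e = 1) {S T : F ≃ₐ[k] F}
    (hSx : S x = algebraMap k F ξ * x) (hSy : S y = y)
    (hTT : T * T ∈ Subgroup.zpowers θ) (hST : S * T * S * T⁻¹ ∈ Subgroup.zpowers θ)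
    (hT : ∀ i : ℕ, T * S ^ i ∉ Subgroup.zpowers θ) :
    ∃ T' : F ≃ₐ[k] F, T' * S * T'⁻¹ = S⁻¹ ∧ T' * T' ∈ Subgroup.zpowers θ ∧
      T⁻¹ * T' ∈ Subgroup.zpowers θ ∧ Commute θ T' := by
  have hn := h.two_le
  have : NeZero n := ⟨by omega⟩
  have hx0 := h.x_ne_zero
  have hy0 := h.y_ne_zero
  have hξ0 : ξ ≠ 0 := by
    rintro rfl
    rw [zero_pow (by have := h.two_le_e; omega)] at hξe
    exact zero_ne_one hξe
  obtain ⟨b, hb, hTx⟩ := h.exists_map_x_eq_div hξ hξ0 hSx hTT hST hT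
  obtain ⟨κ, hκ, hκb, hTy⟩ := h.exists_map_y_eq hb hTx
  rw [hf0, mul_one] at hκb
  have hbF : algebraMap k F b ≠ 0 := (_root_.map_ne_zero _).2 hb
  have hζ := h.isPrimitiveRoot
  -- As `T²` is some `θ^i`, `κ² = ζ^i b^e`. Taking `n`-th powers and using `κ^n = b^(n e)` yields
  -- `κ^(2n) = κ^n`.
  have hκn : κ ^ n = 1 := by
    obtain ⟨i, -, hi⟩ := h.exists_pow_of_mem_zpowers hTT
    have h1 : T (T y) = algebraMap k F (ζ ^ i) * y := by
      rw [← AlgEquiv.mul_apply, ← hi, h.map_pow_y]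
    rw [hTy, map_div₀, map_mul, map_pow, AlgEquiv.commutes, hTx, hTy] at h1
    have h2 : algebraMap k F (κ ^ 2) = algebraMap k F (ζ ^ i * b ^ e) := by
      apply mul_right_cancel₀ hy0
      rw [map_mul, map_pow _ κ, map_pow _ b]
      rw [div_pow] at h1
      field_simp at h1
      rw [h1]; ring
    have h3 := congrArg (· ^ n) ((algebraMap k F).injective h2)
    simp only [mul_pow] at h3
    rw [← pow_mul, ← pow_mul, ← pow_mul, mul_comm i, pow_mul ζ, hζ.pow_eq_one, one_pow, one_mul,
      mul_comm e, ← hκb, mul_comm 2, pow_mul, sq, mul_eq_left₀ (pow_ne_zero _ hκ)] at h3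
    exact h3
  obtain ⟨i, -, hi⟩ := hζ.eq_pow_of_pow_eq_one (ξ := κ⁻¹) (by rw [inv_pow, hκn, inv_one])
  have hT'x : (T * θ ^ i) x = algebraMap k F b / x := by
    rw [AlgEquiv.mul_apply, h.map_pow_x, hTx]
  have hκF : algebraMap k F κ ≠ 0 := (_root_.map_ne_zero _).2 hκ
  have hT'y : (T * θ ^ i) y = y / x ^ e := by
    rw [AlgEquiv.mul_apply, h.map_pow_y, map_mul, AlgEquiv.commutes, hTy, hi, map_inv₀]
    field_simp
  have hξF : algebraMap k F ξ ≠ 0 := (_root_.map_ne_zero _).2 hξ0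
  refine ⟨T * θ ^ i, ?_, ?_, ?_, ?_⟩
  · rw [mul_inv_eq_iff_eq_mul, eq_inv_mul_iff_mul_eq]
    refine h.algEquiv_ext ?_ ?_
    · rw [AlgEquiv.mul_apply, AlgEquiv.mul_apply, hSx, map_mul, AlgEquiv.commutes, hT'x, map_mul,
        map_div₀, AlgEquiv.commutes, AlgEquiv.commutes, hSx]
      field_simp
    · rw [AlgEquiv.mul_apply, AlgEquiv.mul_apply, hSy, hT'y, map_div₀, hSy, map_pow, hSx, mul_pow,
        ← map_pow, hξe, map_one, one_mul]
  · rw [h.mem_zpowers_iff, AlgEquiv.mul_apply, hT'x, map_div₀, AlgEquiv.commutes, hT'x]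
    field_simp
  · rw [← mul_assoc, inv_mul_cancel, one_mul]
    exact Subgroup.npow_mem_zpowers θ i
  · refine h.algEquiv_ext ?_ ?_
    · rw [AlgEquiv.mul_apply, AlgEquiv.mul_apply (T * θ ^ i), h.map_x, hT'x, map_div₀, AlgEquiv.commutes,
        h.map_x]
    · rw [AlgEquiv.mul_apply, AlgEquiv.mul_apply (T * θ ^ i), h.map_y, map_mul, AlgEquiv.commutes, hT'y,
        map_div₀, map_pow, h.map_x, h.map_y, mul_div_assoc]

/-- The automorphism `(x, y) ↦ (ξ x, y)`, of order `m`, meets `⟨θ⟩` trivially. -/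
theorem pow_mem_zpowers_iff (h : IsCyclicCover n e f ζ x y θ) {m : ℕ} {ξ : k}
    (hξ : IsPrimitiveRoot ξ m) {S : F ≃ₐ[k] F} (hSx : S x = algebraMap k F ξ * x) (i : ℕ) :
    S ^ i ∈ Subgroup.zpowers θ ↔ m ∣ i := by
  have h1 : (S ^ i) x = algebraMap k F (ξ ^ i) * x := by
    induction i with
    | zero => simp
    | succ i ih =>
      rw [pow_succ, AlgEquiv.mul_apply, hSx, map_mul, ih, AlgEquiv.commutes, pow_succ, map_mul]
      ring
  rw [h.mem_zpowers_iff, h1, mul_eq_right₀ h.x_ne_zero, ← hξ.pow_eq_one_iff_dvd,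
    ← map_one (algebraMap k F), (algebraMap k F).injective.eq_iff]

end IsCyclicCover

/-! ### Normal forms and upper bounds for group orders. -/

section GroupTheory

variable {G : Type*} [Group G]

theorem exists_normal_form_of_commute {g r : G} (hgr : Commute g r)
    (hgen : Subgroup.closure {g, r} = ⊤) (a : G) : ∃ i j : ℤ, a = g ^ i * r ^ j := by
  have ha : a ∈ Subgroup.closure {g, r} := hgen ▸ Subgroup.mem_top a
  induction ha using Subgroup.closure_induction with
  | mem b hb =>
    rcases hb with rfl | rfl
    · exact ⟨1, 0, by simp⟩
    · exact ⟨0, 1, by simp⟩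
  | one => exact ⟨0, 0, by simp⟩
  | mul a b _ _ iha ihb =>
    obtain ⟨i, j, rfl⟩ := iha
    obtain ⟨i', j', rfl⟩ := ihb
    refine ⟨i + i', j + j', ?_⟩
    rw [zpow_add, zpow_add, (hgr.zpow_zpow i' j).symm.mul_mul_mul_comm]
  | inv a _ iha =>
    obtain ⟨i, j, rfl⟩ := iha
    refine ⟨-i, -j, ?_⟩
    rw [mul_inv_rev, ← zpow_neg, ← zpow_neg, (hgr.zpow_zpow (-i) (-j)).eq]

theorem exists_normal_form {g r t : G} (hgr : Commute g r) (hgt : Commute g t)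
    (htr : t * r * t⁻¹ = r⁻¹) (ht : t * t ∈ Subgroup.zpowers g)
    (hgen : Subgroup.closure {g, r, t} = ⊤) (a : G) :
    ∃ i j : ℤ, a = g ^ i * r ^ j ∨ a = g ^ i * r ^ j * t := by
  obtain ⟨c, hc⟩ := ht
  simp only at hc
  have hr' : ∀ j : ℤ, t * r ^ j = r ^ (-j) * t := fun j => by
    rw [← mul_inv_eq_iff_eq_mul, ← conj_zpow, htr, inv_zpow, zpow_neg]
  have hg' : ∀ i : ℤ, t * g ^ i = g ^ i * t := fun i => (hgt.zpow_left i).eq.symm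
  have hr : ∀ i : ℤ, r * g ^ i = g ^ i * r := fun i => (hgr.zpow_left i).eq.symm
  have hri : ∀ i : ℤ, r⁻¹ * g ^ i = g ^ i * r⁻¹ := fun i => (hgr.inv_right.zpow_left i).eq.symm
  have hleft : ∀ a : G, (∃ i j : ℤ, a = g ^ i * r ^ j ∨ a = g ^ i * r ^ j * t) →
      ∃ i j : ℤ, t * a = g ^ i * r ^ j ∨ t * a = g ^ i * r ^ j * t := by
    rintro _ ⟨i, j, rfl | rfl⟩
    · refine ⟨i, -j, Or.inr ?_⟩
      rw [← mul_assoc, hg', mul_assoc, hr', mul_assoc]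
    · refine ⟨i + c, -j, Or.inl ?_⟩
      have h1 : r ^ (-j) * g ^ c = g ^ c * r ^ (-j) := (hgr.zpow_zpow c (-j)).eq.symm
      rw [← mul_assoc, ← mul_assoc, hg', mul_assoc (g ^ i), hr', mul_assoc, mul_assoc, ← hc, h1,
        ← mul_assoc, zpow_add]
  have hgleft : ∀ (l : ℤ) (a : G), (∃ i j : ℤ, a = g ^ i * r ^ j ∨ a = g ^ i * r ^ j * t) →
      ∃ i j : ℤ, g ^ l * a = g ^ i * r ^ j ∨ g ^ l * a = g ^ i * r ^ j * t := by
    rintro l _ ⟨i, j, rfl | rfl⟩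
    · exact ⟨l + i, j, Or.inl (by rw [zpow_add, mul_assoc])⟩
    · exact ⟨l + i, j, Or.inr (by simp only [zpow_add, mul_assoc])⟩
  have ha : a ∈ Subgroup.closure {g, r, t} := hgen ▸ Subgroup.mem_top a
  induction ha using Subgroup.closure_induction_left with
  | one => exact ⟨0, 0, Or.inl (by simp)⟩
  | mul_left b hb a _ ih =>
    rcases hb with rfl | rfl | rfl
    · simpa using hgleft 1 a ih
    · obtain ⟨i, j, rfl | rfl⟩ := ih
      · exact ⟨i, 1 + j, Or.inl (by rw [← mul_assoc, hr, zpow_add, zpow_one, mul_assoc])⟩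
      · refine ⟨i, 1 + j, Or.inr ?_⟩
        rw [← mul_assoc, ← mul_assoc, hr, zpow_add, zpow_one, ← mul_assoc]
    · exact hleft a ih
  | inv_mul_cancel b hb a _ ih =>
    rcases hb with rfl | rfl | rfl
    · simpa using hgleft (-1) a ih
    · obtain ⟨i, j, rfl | rfl⟩ := ih
      · exact ⟨i, -1 + j, Or.inl (by rw [← mul_assoc, hri, zpow_add, zpow_neg_one, mul_assoc])⟩
      · refine ⟨i, -1 + j, Or.inr ?_⟩
        rw [← mul_assoc, ← mul_assoc, hri, zpow_add, zpow_neg_one, ← mul_assoc]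
    · have h1 : b⁻¹ * a = g ^ (-c) * (b * a) := by
        rw [zpow_neg, hc]; group
      rw [h1]
      exact hgleft (-c) _ (hleft a ih)

theorem exists_reduced_form {n m : ℕ} (hn : n ≠ 0) (hm : m ≠ 0) {g r : G} (hg : g ^ n = 1)
    (hr : r ^ m ∈ Subgroup.zpowers g) (i j : ℤ) :
    ∃ (i' : Fin n) (j' : Fin m), g ^ i * r ^ j = g ^ (i' : ℕ) * r ^ (j' : ℕ) := by
  obtain ⟨b, hb⟩ := hr
  simp only at hb
  have hred : ∀ i : ℤ, ∃ i' : Fin n, g ^ i = g ^ (i' : ℕ) := fun i => by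
    refine ⟨⟨(i % n).toNat, ?_⟩, ?_⟩
    · have := Int.emod_lt_of_pos i (by omega : (0 : ℤ) < n)
      omega
    · rw [← zpow_natCast, Int.toNat_of_nonneg (Int.emod_nonneg i (by omega)),
        zpow_eq_zpow_emod' i hg]
  obtain ⟨i', hi'⟩ := hred (i + b * (j / m))
  refine ⟨i', ⟨(j % m).toNat, ?_⟩, ?_⟩
  · have := Int.emod_lt_of_pos j (by omega : (0 : ℤ) < m)
    omega
  · rw [← hi', zpow_add, zpow_mul, hb, ← zpow_natCast r (Int.toNat _),
      Int.toNat_of_nonneg (Int.emod_nonneg j (by omega)), ← zpow_natCast r m, ← zpow_mul, mul_assoc,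
      ← zpow_add, Int.mul_ediv_add_emod]

theorem card_le_of_commute {n m : ℕ} (hn : n ≠ 0) (hm : m ≠ 0) {g r : G} (hg : g ^ n = 1)
    (hr : r ^ m ∈ Subgroup.zpowers g) (hgr : Commute g r)
    (hgen : Subgroup.closure {g, r} = ⊤) : Finite G ∧ Nat.card G ≤ n * m := by
  have hsurj : Function.Surjective fun p : Fin n × Fin m => g ^ (p.1 : ℕ) * r ^ (p.2 : ℕ) := by
    intro a
    obtain ⟨i, j, rfl⟩ := exists_normal_form_of_commute hgr hgen a
    obtain ⟨i', j', h⟩ := exists_reduced_form hn hm hg hr i j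
    exact ⟨(i', j'), h.symm⟩
  exact ⟨Finite.of_surjective _ hsurj, by simpa using Nat.card_le_card_of_surjective _ hsurj⟩

/-- Every element is `g^i r^j t^ε` with reduced exponents and `ε` in `{0, 1}`. -/
theorem card_le_of_dihedral {n m : ℕ} (hn : n ≠ 0) (hm : m ≠ 0) {g r t : G} (hg : g ^ n = 1)
    (hr : r ^ m ∈ Subgroup.zpowers g) (hgr : Commute g r) (hgt : Commute g t)
    (htr : t * r * t⁻¹ = r⁻¹) (ht : t * t ∈ Subgroup.zpowers g)
    (hgen : Subgroup.closure {g, r, t} = ⊤) : Finite G ∧ Nat.card G ≤ n * m * 2 := by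
  have hsurj : Function.Surjective fun p : (Fin n × Fin m) × Fin 2 =>
      g ^ (p.1.1 : ℕ) * r ^ (p.1.2 : ℕ) * t ^ (p.2 : ℕ) := by
    intro a
    obtain ⟨i, j, h⟩ := exists_normal_form hgr hgt htr ht hgen a
    obtain ⟨i', j', h'⟩ := exists_reduced_form hn hm hg hr i j
    rcases h with rfl | rfl
    · exact ⟨((i', j'), 0), by simp [h']⟩
    · exact ⟨((i', j'), 1), by simp [h']⟩
  exact ⟨Finite.of_surjective _ hsurj, by simpa using Nat.card_le_card_of_surjective _ hsurj⟩

theorem MonoidHom.surjective_of_closure {A : Type*} [Group A] (φ : A →* G) {s : Set G}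
    (hs : Subgroup.closure s = ⊤) (h : ∀ a ∈ s, a ∈ φ.range) : Function.Surjective φ := by
  rw [← MonoidHom.range_eq_top, eq_top_iff, ← hs, Subgroup.closure_le]
  exact h

/-- Thanks to this an upper bound on the order of a presented group suffices to identify it with
`G`; its exact order comes for free. -/
theorem nonempty_mulEquiv_of_surjective {A : Type*} [Group A] [Finite A] (φ : A →* G)
    (hφ : Function.Surjective φ) (hcard : Nat.card A ≤ Nat.card G) : Nonempty (G ≃* A) :=
  ⟨(MulEquiv.ofBijective φ (hφ.bijective_of_nat_card_le hcard)).symm⟩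

/-- The homomorphism from the cyclic group of order `n` sending the generator to `g`. -/
noncomputable def CyclicGrp.lift (n : ℕ) (g : G) (hg : g ^ n = 1) : CyclicGrp n →* G :=
  AddMonoidHom.toMultiplicativeLeft (ZMod.lift n ⟨zmultiplesHom (Additive G) (Additive.ofMul g), by
    simpa using congrArg Additive.ofMul hg⟩)

theorem CyclicGrp.lift_intCast (n : ℕ) (g : G) (hg : g ^ n = 1) (i : ℤ) :
    CyclicGrp.lift n g hg (Multiplicative.ofAdd (i : ZMod n)) = g ^ i := by
  simp [CyclicGrp.lift]

/-- The homomorphism from the dihedral group sending `r 1` to `r` and `sr 0` to `t`. -/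
noncomputable def DihedralGroup.homOfRelations (m : ℕ) (r t : G) (hr : r ^ m = 1) (ht : t * t = 1)
    (htr : t * r * t⁻¹ = r⁻¹) : DihedralGroup m →* G :=
  MonoidHom.mk' (fun a => match a with
    | .r i => CyclicGrp.lift m r hr (Multiplicative.ofAdd i)
    | .sr i => t * CyclicGrp.lift m r hr (Multiplicative.ofAdd i)) (by
    have hcomm : ∀ i : ℤ, r ^ i * t = t * r ^ (-i) := fun i => by
      have h1 : t * r ^ (-i) * t⁻¹ = r ^ i := by
        rw [← conj_zpow, htr, inv_zpow, zpow_neg, inv_inv]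
      rw [← h1]; group
    rintro (i | i) (j | j) <;>
    obtain ⟨i, rfl⟩ := ZMod.intCast_surjective i <;>
    obtain ⟨j, rfl⟩ := ZMod.intCast_surjective j
    · simp only [DihedralGroup.r_mul_r, ← Int.cast_add, CyclicGrp.lift_intCast, zpow_add]
    · simp only [DihedralGroup.r_mul_sr, ← Int.cast_sub, CyclicGrp.lift_intCast]
      rw [← mul_assoc, hcomm, mul_assoc, ← zpow_add, neg_add_eq_sub]
    · simp only [DihedralGroup.sr_mul_r, ← Int.cast_add, CyclicGrp.lift_intCast, zpow_add,
        mul_assoc]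
    · simp only [DihedralGroup.sr_mul_sr, ← Int.cast_sub, CyclicGrp.lift_intCast]
      rw [mul_assoc t, ← mul_assoc (r ^ i), hcomm, mul_assoc t, ← mul_assoc t t, ht, one_mul,
        ← zpow_add, neg_add_eq_sub])

theorem nonempty_mulEquiv_dihedral_prod {n m : ℕ} (hn : n ≠ 0) (hm : m ≠ 0) {g r t : G}
    (hg : g ^ n = 1) (hr : r ^ m = 1) (hgr : Commute g r) (hgt : Commute g t)
    (htr : t * r * t⁻¹ = r⁻¹) (ht : t * t = 1) (hgen : Subgroup.closure {g, r, t} = ⊤)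
    (hcard : Nat.card G = n * m * 2) : Nonempty (G ≃* DihedralGroup m × CyclicGrp n) := by
  have : NeZero n := ⟨hn⟩
  have : NeZero m := ⟨hm⟩
  let φ := (DihedralGroup.homOfRelations m r t hr ht htr).noncommCoprod (CyclicGrp.lift n g hg) (by
    rintro (i | i) j <;>
    obtain ⟨i, rfl⟩ := ZMod.intCast_surjective i <;>
    obtain ⟨j, rfl⟩ : ∃ j' : ℤ, Multiplicative.ofAdd (j' : ZMod n) = j :=
      ZMod.intCast_surjective (Multiplicative.toAdd j)
    · simp only [DihedralGroup.homOfRelations, MonoidHom.mk'_apply, CyclicGrp.lift_intCast]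
      exact (hgr.zpow_zpow j i).symm
    · simp only [DihedralGroup.homOfRelations, MonoidHom.mk'_apply, CyclicGrp.lift_intCast]
      exact ((hgt.zpow_left j).mul_right (hgr.zpow_zpow j i)).symm)
  refine nonempty_mulEquiv_of_surjective φ (φ.surjective_of_closure hgen ?_) ?_
  · rintro a (rfl | rfl | rfl)
    · refine ⟨(1, Multiplicative.ofAdd ((1 : ℤ) : ZMod n)), ?_⟩
      rw [MonoidHom.noncommCoprod_apply, map_one, one_mul, CyclicGrp.lift_intCast, zpow_one]
    · refine ⟨(.r ((1 : ℤ) : ZMod m), 1), ?_⟩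
      rw [MonoidHom.noncommCoprod_apply, map_one, mul_one]
      simp only [DihedralGroup.homOfRelations, MonoidHom.mk'_apply, CyclicGrp.lift_intCast,
        zpow_one]
    · refine ⟨(.sr ((0 : ℤ) : ZMod m), 1), ?_⟩
      rw [MonoidHom.noncommCoprod_apply, map_one, mul_one]
      simp only [DihedralGroup.homOfRelations, MonoidHom.mk'_apply, CyclicGrp.lift_intCast,
        zpow_zero, mul_one]
  · rw [hcard, Nat.card_prod, DihedralGroup.nat_card, Nat.card_eq_fintype_card (α := CyclicGrp n),
      Fintype.card_multiplicative, ZMod.card]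
    apply le_of_eq; ring

end GroupTheory

/-! ### Recognising extensions with cyclic or dihedral quotient. -/

section GroupTheory

variable {G : Type*} [Group G]

theorem commute_of_relation {g s : G} (h : s * g * s⁻¹ * g⁻¹ = 1) : Commute g s := by
  rw [mul_inv_eq_one, mul_inv_eq_iff_eq_mul] at h
  exact h.symm

theorem commute_of_relation_pow_one {g s : G} (h : s * g * s⁻¹ * (g ^ 1)⁻¹ = 1) :
    Commute g s :=
  commute_of_relation (by rwa [pow_one] at h)

/-- The rotation is `s t`: since `t (s t) t⁻¹ (s t) = t s² t = g t² = 1`, it is inverted by `t`, and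
the dihedral count applies. -/
theorem card_le_of_extGrp_relations {n m a b : ℕ} (hn : n ≠ 0) (hm : m ≠ 0) (ha : a = n - 1)
    {g s t : G} (hg : g ^ n = 1) (hs : s ^ 2 * g⁻¹ = 1) (ht : t ^ 2 * (g ^ a)⁻¹ = 1)
    (hst : (s * t) ^ m * (g ^ b)⁻¹ = 1) (hgs : Commute g s) (hgt : Commute g t)
    (hgen : Subgroup.closure {g, s, t} = ⊤) : Finite G ∧ Nat.card G ≤ n * m * 2 := by
  rw [mul_inv_eq_one] at hs ht hst
  have hgt2 : g * (t * t) = 1 := by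
    rw [← sq, ht, ← pow_succ', ha, Nat.sub_add_cancel (Nat.one_le_iff_ne_zero.2 hn), hg]
  have hconj : t * (s * t) * t⁻¹ = (s * t)⁻¹ := by
    rw [eq_inv_iff_mul_eq_one]
    calc t * (s * t) * t⁻¹ * (s * t) = t * (s ^ 2) * t := by rw [sq]; group
      _ = 1 := by rw [hs, ← hgt.eq, mul_assoc, hgt2]
  have hclos : Subgroup.closure {g, s * t, t} = ⊤ := by
    rw [eq_top_iff, ← hgen, Subgroup.closure_le]
    have hst' : s * t ∈ Subgroup.closure {g, s * t, t} := Subgroup.subset_closure (by simp)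
    have ht' : t ∈ Subgroup.closure {g, s * t, t} := Subgroup.subset_closure (by simp)
    rintro a (rfl | rfl | rfl)
    · exact Subgroup.subset_closure (by simp)
    · have := mul_mem hst' (inv_mem ht')
      rwa [mul_inv_cancel_right] at this
    · exact ht'
  exact card_le_of_dihedral (g := g) (r := s * t) (t := t) hn hm hg
    (by rw [hst]; exact Subgroup.npow_mem_zpowers g b) (hgs.mul_right hgt) hgt hconj
    (by rw [← sq, ht]; exact Subgroup.npow_mem_zpowers g _) hclos

theorem nonempty_mulEquiv_metacyclic_one {n m : ℕ} (hn : n ≠ 0) (hm : m ≠ 0) {g r : G}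
    (hg : g ^ n = 1) (hr : r ^ m = 1) (hgr : Commute g r)
    (hgen : Subgroup.closure {g, r} = ⊤) (hcard : Nat.card G = n * m) :
    Nonempty (G ≃* MetacyclicGrp n m 1) := by
  have hrel : ∀ w ∈ ({FreeGroup.of 0 ^ n, FreeGroup.of 1 ^ m, FreeGroup.of 1 * FreeGroup.of 0 *
      (FreeGroup.of 1)⁻¹ * (FreeGroup.of 0 ^ 1)⁻¹} : Set (FreeGroup (Fin 2))),
      FreeGroup.lift ![g, r] w = 1 := by
    rintro w (rfl | rfl | rfl)
    · simpa using hg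
    · simpa using hr
    · simp [← hgr.eq]
  let φ : MetacyclicGrp n m 1 →* G := PresentedGroup.toGroup hrel
  let γ : MetacyclicGrp n m 1 := PresentedGroup.of 0
  let σ : MetacyclicGrp n m 1 := PresentedGroup.of 1
  have h1 : γ ^ n = 1 := PresentedGroup.one_of_mem (by simp)
  have h2 : σ ^ m = 1 := PresentedGroup.one_of_mem (by simp)
  have h3 : σ * γ * σ⁻¹ * (γ ^ 1)⁻¹ = 1 := PresentedGroup.one_of_mem (by simp)
  have hcomm : Commute γ σ := commute_of_relation_pow_one h3
  have hclos : Subgroup.closure {γ, σ} = ⊤ := by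
    rw [← PresentedGroup.closure_range_of]
    congr 1
    ext a
    simp only [Set.mem_insert_iff, Set.mem_singleton_iff, Set.mem_range, Fin.exists_fin_two]
    exact or_congr eq_comm eq_comm
  obtain ⟨hfin, hle⟩ := card_le_of_commute hn hm h1 (by rw [h2]; exact one_mem _) hcomm hclos
  refine nonempty_mulEquiv_of_surjective φ (φ.surjective_of_closure hgen ?_) (hcard ▸ hle)
  rintro a (rfl | rfl)
  · exact ⟨γ, PresentedGroup.toGroup.of hrel⟩
  · exact ⟨σ, PresentedGroup.toGroup.of hrel⟩

theorem nonempty_mulEquiv_extGrp {n m b : ℕ} (hn : n ≠ 0) (hm : m ≠ 0) {g s t : G}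
    (hg : g ^ n = 1) (hs : s ^ 2 = g) (ht : t ^ 2 = g ^ (n - 1)) (hst : (s * t) ^ m = g ^ b)
    (hgs : Commute g s) (hgt : Commute g t) (hgen : Subgroup.closure {g, s, t} = ⊤)
    (hcard : Nat.card G = n * m * 2) : Nonempty (G ≃* ExtGrp n m (n - 1) b 1) := by
  have hrel : ∀ w ∈ ({FreeGroup.of 0 ^ n, FreeGroup.of 1 ^ 2 * (FreeGroup.of 0)⁻¹,
      FreeGroup.of 2 ^ 2 * (FreeGroup.of 0 ^ (n - 1))⁻¹,
      (FreeGroup.of 1 * FreeGroup.of 2) ^ m * (FreeGroup.of 0 ^ b)⁻¹,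
      FreeGroup.of 1 * FreeGroup.of 0 * (FreeGroup.of 1)⁻¹ * (FreeGroup.of 0)⁻¹,
      FreeGroup.of 2 * FreeGroup.of 0 * (FreeGroup.of 2)⁻¹ * (FreeGroup.of 0 ^ 1)⁻¹} :
      Set (FreeGroup (Fin 3))), FreeGroup.lift ![g, s, t] w = 1 := by
    rintro w (rfl | rfl | rfl | rfl | rfl | rfl)
    · simpa using hg
    · simp [hs]
    · simp [ht]
    · simp [hst]
    · simp [← hgs.eq]
    · simp [← hgt.eq]
  let φ : ExtGrp n m (n - 1) b 1 →* G := PresentedGroup.toGroup hrel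
  let γ : ExtGrp n m (n - 1) b 1 := PresentedGroup.of 0
  let σ : ExtGrp n m (n - 1) b 1 := PresentedGroup.of 1
  let τ : ExtGrp n m (n - 1) b 1 := PresentedGroup.of 2
  have h1 : γ ^ n = 1 := PresentedGroup.one_of_mem (by simp)
  have h2 : σ ^ 2 * γ⁻¹ = 1 := PresentedGroup.one_of_mem (by simp)
  have h3 : τ ^ 2 * (γ ^ (n - 1))⁻¹ = 1 := PresentedGroup.one_of_mem (by simp)
  have h4 : (σ * τ) ^ m * (γ ^ b)⁻¹ = 1 := PresentedGroup.one_of_mem (by simp)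
  have h5 : σ * γ * σ⁻¹ * γ⁻¹ = 1 := PresentedGroup.one_of_mem (by simp)
  have h6 : τ * γ * τ⁻¹ * (γ ^ 1)⁻¹ = 1 := PresentedGroup.one_of_mem (by simp)
  have hclos : Subgroup.closure {γ, σ, τ} = ⊤ := by
    rw [eq_top_iff, ← PresentedGroup.closure_range_of, Subgroup.closure_le]
    rintro _ ⟨i, rfl⟩
    fin_cases i <;> exact Subgroup.subset_closure (by simp [γ, σ, τ])
  obtain ⟨hfin, hle⟩ := card_le_of_extGrp_relations hn hm rfl h1 h2 h3 h4
    (commute_of_relation h5) (commute_of_relation_pow_one h6) hclos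
  refine nonempty_mulEquiv_of_surjective φ (φ.surjective_of_closure hgen ?_) (hcard ▸ hle)
  rintro a (rfl | rfl | rfl)
  · exact ⟨γ, PresentedGroup.toGroup.of hrel⟩
  · exact ⟨σ, PresentedGroup.toGroup.of hrel⟩
  · exact ⟨τ, PresentedGroup.toGroup.of hrel⟩

/-- For `m > 2` an element of order `m` is a rotation. For `m = 2` it need not be, but every element
outside `⟨s⟩` works since the group has exponent two and is not cyclic. -/
theorem DihedralGroup.exists_reflection {m : ℕ} (hm : 2 ≤ m) {s : DihedralGroup m}
    (hs : orderOf s = m) :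
    ∃ t : DihedralGroup m, t * t = 1 ∧ s * t * s * t⁻¹ = 1 ∧ t ∉ Subgroup.zpowers s := by
  rcases eq_or_lt_of_le hm with rfl | hm
  · have h1 : ∀ s t : DihedralGroup 2, t * t = 1 ∧ s * t * s * t⁻¹ = 1 := by decide
    by_contra! hcon
    have htop : Subgroup.zpowers s = ⊤ := by
      rw [eq_top_iff]
      exact fun t _ => hcon t (h1 s t).1 (h1 s t).2
    have h2 := Nat.card_zpowers s
    rw [htop, Subgroup.card_top, DihedralGroup.nat_card, hs] at h2
    omega
  · rcases s with i | i
    · refine ⟨.sr 0, DihedralGroup.sr_mul_self 0, by simp, ?_⟩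
      rintro ⟨j, hj⟩
      simp at hj
    · rw [DihedralGroup.orderOf_sr] at hs
      omega

variable {n m : ℕ} {g r : G}

theorem orderOf_mk_eq [(Subgroup.zpowers g).Normal]
    (hri : ∀ i : ℕ, r ^ i ∈ Subgroup.zpowers g ↔ m ∣ i) :
    orderOf (r : G ⧸ Subgroup.zpowers g) = m := by
  refine Nat.dvd_right_iff_eq.1 fun i => ?_
  rw [orderOf_dvd_iff_pow_eq_one, ← QuotientGroup.mk_pow, QuotientGroup.eq_one_iff, hri]

theorem card_eq_of_quotient (hg : orderOf g = n) {c : ℕ}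
    (hc : Nat.card (G ⧸ Subgroup.zpowers g) = c) : Nat.card G = c * n := by
  rw [Subgroup.card_eq_card_quotient_mul_card_subgroup (Subgroup.zpowers g), hc,
    Nat.card_zpowers, hg]

theorem Subgroup.eq_top_of_quotient [(Subgroup.zpowers g).Normal] {K : Subgroup G} (hg : g ∈ K)
    (hK : K.map (QuotientGroup.mk' (Subgroup.zpowers g)) = ⊤) : K = ⊤ := by
  have h1 : (QuotientGroup.mk' (Subgroup.zpowers g)).ker ≤ K := by
    rw [QuotientGroup.ker_mk', Subgroup.zpowers_le]
    exact hg
  rw [← Subgroup.comap_map_eq_self h1, hK, Subgroup.comap_top]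

/-- An extension of `C_m` by a cyclic group whose quotient is generated by the image of an element
of order `m` commuting with the kernel. -/
theorem mulEquiv_of_cyclic_quotient (hn : n ≠ 0) (hm : m ≠ 0) [(Subgroup.zpowers g).Normal]
    (hg : orderOf g = n) (hgr : Commute g r) (hr : r ^ m = 1)
    (hri : ∀ i : ℕ, r ^ i ∈ Subgroup.zpowers g ↔ m ∣ i)
    (hcard : Nat.card (G ⧸ Subgroup.zpowers g) = m) :
    (m.Coprime n ∧ Nonempty (G ≃* CyclicGrp (m * n))) ∨
      (¬ m.Coprime n ∧ Nonempty (G ≃* MetacyclicGrp n m 1)) := by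
  have hG := card_eq_of_quotient hg hcard
  have hrord := orderOf_mk_eq hri
  have hfinQ : Finite (G ⧸ Subgroup.zpowers g) := Nat.finite_of_card_ne_zero (by omega)
  have : NeZero (m * n) := ⟨mul_ne_zero hm hn⟩
  by_cases hcop : m.Coprime n
  · refine Or.inl ⟨hcop, ?_⟩
    have hr' : orderOf r = m := Nat.dvd_antisymm (orderOf_dvd_of_pow_eq_one hr)
      ((hri _).1 (by rw [pow_orderOf_eq_one]; exact one_mem _))
    have hfin : Finite G := Nat.finite_of_card_ne_zero (by rw [hG]; exact mul_ne_zero hm hn)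
    have hord : orderOf (g * r) = Nat.card G := by
      rw [hgr.orderOf_mul_eq_mul_orderOf_of_coprime (by rw [hg, hr']; exact hcop.symm), hg, hr',
        hG, mul_comm]
    have := isCyclic_of_orderOf_eq_card (g * r) hord
    exact ⟨mulEquivOfCyclicCardEq (by rw [hG]; simp)⟩
  · refine Or.inr ⟨hcop, nonempty_mulEquiv_metacyclic_one hn hm (hg ▸ pow_orderOf_eq_one g) hr hgr
      ?_ (by rw [hG, mul_comm])⟩
    refine Subgroup.eq_top_of_quotient (g := g) (Subgroup.subset_closure (by simp)) ?_
    rw [eq_top_iff, ← Subgroup.eq_top_of_card_eq (Subgroup.zpowers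
      (r : G ⧸ Subgroup.zpowers g)) (by rw [Nat.card_zpowers, hrord, hcard]), Subgroup.zpowers_le]
    exact ⟨r, Subgroup.subset_closure (by simp), rfl⟩

theorem exists_lift_of_dihedral_quotient (hm : 2 ≤ m) [(Subgroup.zpowers g).Normal]
    (hri : ∀ i : ℕ, r ^ i ∈ Subgroup.zpowers g ↔ m ∣ i)
    (e : (G ⧸ Subgroup.zpowers g) ≃* DihedralGroup m) :
    ∃ t : G, t * t ∈ Subgroup.zpowers g ∧ r * t * r * t⁻¹ ∈ Subgroup.zpowers g ∧
      (t : G ⧸ Subgroup.zpowers g) ∉ Subgroup.zpowers (r : G ⧸ Subgroup.zpowers g) := by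
  obtain ⟨t, h1, h2, h3⟩ := DihedralGroup.exists_reflection hm
    (s := e (r : G ⧸ Subgroup.zpowers g)) (by rw [MulEquiv.orderOf_eq, orderOf_mk_eq hri])
  obtain ⟨t, rfl⟩ := e.surjective t
  obtain ⟨t, rfl⟩ := QuotientGroup.mk_surjective t
  refine ⟨t, ?_, ?_, fun ⟨i, hi⟩ => h3 ⟨i, ?_⟩⟩
  · rw [← QuotientGroup.eq_one_iff, QuotientGroup.mk_mul]
    exact e.injective (by rw [map_mul, h1, map_one])
  · rw [← QuotientGroup.eq_one_iff]
    simp only [QuotientGroup.mk_mul, QuotientGroup.mk_inv]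
    exact e.injective (by simp only [map_mul, map_inv, h2, map_one])
  · simp only at hi ⊢
    rw [← hi, map_zpow]

/-- The image of `r` generates a subgroup of index two, so one further element generates the
quotient. -/
theorem closure_eq_top_of_dihedral_quotient (hm : m ≠ 0) [(Subgroup.zpowers g).Normal]
    (hri : ∀ i : ℕ, r ^ i ∈ Subgroup.zpowers g ↔ m ∣ i)
    (hcard : Nat.card (G ⧸ Subgroup.zpowers g) = 2 * m) {t : G}
    (ht : (t : G ⧸ Subgroup.zpowers g) ∉ Subgroup.zpowers (r : G ⧸ Subgroup.zpowers g)) :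
    Subgroup.closure {g, r, t} = ⊤ := by
  have hfinQ : Finite (G ⧸ Subgroup.zpowers g) := Nat.finite_of_card_ne_zero (by omega)
  refine Subgroup.eq_top_of_quotient (g := g) (Subgroup.subset_closure (by simp)) ?_
  set K := (Subgroup.closure {g, r, t}).map (QuotientGroup.mk' (Subgroup.zpowers g)) with hK
  have hr' : (r : G ⧸ Subgroup.zpowers g) ∈ K := ⟨r, Subgroup.subset_closure (by simp), rfl⟩
  have ht' : (t : G ⧸ Subgroup.zpowers g) ∈ K := ⟨t, Subgroup.subset_closure (by simp), rfl⟩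
  have hle : Subgroup.zpowers (r : G ⧸ Subgroup.zpowers g) ≤ K := Subgroup.zpowers_le.2 hr'
  have hc : Nat.card (Subgroup.zpowers (r : G ⧸ Subgroup.zpowers g)) = m := by
    rw [Nat.card_zpowers, orderOf_mk_eq hri]
  obtain ⟨a, ha⟩ := Subgroup.card_dvd_of_le hle
  obtain ⟨b, hb⟩ := Subgroup.card_subgroup_dvd_card K
  rw [hc] at ha
  rw [hcard, ha, mul_comm 2, mul_assoc] at hb
  have hab := Nat.eq_of_mul_eq_mul_left (by omega : 0 < m) hb
  have ha1 : a ≠ 1 := by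
    rintro rfl
    have := Subgroup.eq_of_le_of_card_ge hle (by rw [hc, ha, mul_one])
    exact ht (this ▸ ht')
  have ha2 : a = 2 := by
    have : a ∣ 2 := ⟨b, hab⟩
    exact ((Nat.dvd_prime Nat.prime_two).1 this).resolve_left ha1
  exact Subgroup.eq_top_of_card_eq _ (by rw [ha, hcard, ha2, mul_comm])

/-- A central extension of the dihedral group by a cyclic group in which the rotations lift. -/
theorem mulEquiv_of_dihedral_quotient (hn : n ≠ 0) (hm : m ≠ 0) (hg : orderOf g = n) {t : G}
    (hr : r ^ m = 1) (hgr : Commute g r) (hgt : Commute g t) (htr : t * r * t⁻¹ = r⁻¹)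
    (ht : t * t ∈ Subgroup.zpowers g) (hgen : Subgroup.closure {g, r, t} = ⊤)
    (hcard : Nat.card G = n * m * 2) :
    Nonempty (G ≃* DihedralGroup m × CyclicGrp n) ∨ Even n ∧
      ((Even m ∧ Nonempty (G ≃* GroupG2 n m)) ∨ (Odd m ∧ Nonempty (G ≃* GroupG4 n m))) := by
  have hgn : g ^ n = 1 := hg ▸ pow_orderOf_eq_one g
  obtain ⟨c, hc⟩ := ht
  simp only at hc
  -- Replacing `t` by `t g^d` keeps all relations and changes the exponent of its square by `2 d`.
  have hshift : ∀ d : ℤ, Commute g (t * g ^ d) ∧ (t * g ^ d) * r * (t * g ^ d)⁻¹ = r⁻¹ ∧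
      (t * g ^ d) * (t * g ^ d) = g ^ (c + 2 * d) ∧
      Subgroup.closure {g, r, t * g ^ d} = ⊤ := by
    intro d
    refine ⟨hgt.mul_right ((Commute.refl g).zpow_right d), ?_, ?_, ?_⟩
    · rw [mul_assoc t, (hgr.zpow_left d).eq, ← htr]; group
    · rw [(hgt.zpow_left d).mul_mul_mul_comm, ← hc, ← zpow_add, ← zpow_add]
      congr 1; ring
    · rw [eq_top_iff, ← hgen, Subgroup.closure_le]
      have h1 : g ∈ Subgroup.closure {g, r, t * g ^ d} := Subgroup.subset_closure (by simp)
      have h2 : t * g ^ d ∈ Subgroup.closure {g, r, t * g ^ d} :=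
        Subgroup.subset_closure (by simp)
      rintro a (rfl | rfl | rfl)
      · exact h1
      · exact Subgroup.subset_closure (by simp)
      · have := mul_mem h2 (inv_mem (zpow_mem h1 d))
        rwa [mul_inv_cancel_right] at this
  have hgz : ∀ i : ℤ, g ^ (n * i : ℤ) = 1 := fun i => by
    rw [zpow_mul, zpow_natCast, hgn, one_zpow]
  -- The square can be made trivial unless `n` is even and `c` odd; then it can be made equal to
  -- `g`.
  by_cases hsq : ∃ d i : ℤ, c + 2 * d = n * i
  · obtain ⟨d, i, hd⟩ := hsq
    obtain ⟨h1, h2, h3, h4⟩ := hshift d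
    rw [hd, hgz] at h3
    exact Or.inl (nonempty_mulEquiv_dihedral_prod hn hm hgn hr hgr h1 h2 h3 h4 hcard)
  · have hceven : ¬ Even c := fun ⟨a, ha⟩ => hsq ⟨-a, 0, by omega⟩
    have hneven : Even n := by
      by_contra hodd
      rw [Nat.not_even_iff_odd] at hodd
      rw [Int.not_even_iff_odd] at hceven
      obtain ⟨a, ha⟩ := hodd
      obtain ⟨b, hb⟩ := hceven
      exact hsq ⟨a - b, 1, by omega⟩
    rw [Int.not_even_iff_odd] at hceven
    obtain ⟨a, ha⟩ := hceven
    obtain ⟨hgs, hsr, hss, hsgen⟩ := hshift (-a)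
    set s := t * g ^ (-a) with hs
    rw [show c + 2 * -a = 1 by omega, zpow_one] at hss
    refine Or.inr ⟨hneven, ?_⟩
    -- The third generator is `s⁻¹ r g^b`, so that its product with `s` is `r g^b`, whose `m`-th
    -- power is `g^(b m)`. The condition `g^(2b) = 1` keeps its square equal to `g⁻¹`.
    have hkey : ∀ b b' : ℕ, g ^ (2 * b) = 1 → g ^ (b * m) = g ^ b' →
        Nonempty (G ≃* ExtGrp n m (n - 1) b' 1) := by
      intro b b' hb hbb'
      have hgb : Commute r (g ^ b) := (hgr.pow_left b).symm
      have hst : s * (s⁻¹ * (r * g ^ b)) = r * g ^ b := mul_inv_cancel_left s _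
      have hgst : Commute g (s⁻¹ * (r * g ^ b)) :=
        hgs.inv_right.mul_right (hgr.mul_right ((Commute.refl g).pow_right b))
      refine nonempty_mulEquiv_extGrp (s := s) (t := s⁻¹ * (r * g ^ b)) hn hm hgn
        (by rw [sq, hss]) ?_ ?_ hgs hgst ?_ hcard
      · have h1 : g ^ (n - 1) = g⁻¹ := by
          rw [eq_inv_iff_mul_eq_one, ← pow_succ, Nat.sub_add_cancel (Nat.one_le_iff_ne_zero.2 hn),
            hgn]
        have h2 : s⁻¹ * r = r⁻¹ * s⁻¹ := by
          have h3 : s * r⁻¹ * s⁻¹ = r := by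
            simpa [mul_assoc] using congrArg (·⁻¹) hsr
          calc s⁻¹ * r = s⁻¹ * (s * r⁻¹ * s⁻¹) := by rw [h3]
            _ = r⁻¹ * s⁻¹ := by group
        have hgbs : Commute (g ^ b) (s⁻¹ * r) := (hgs.inv_right.mul_right hgr).pow_left b
        rw [h1, ← mul_assoc, ← hgbs.eq, sq, hgbs.symm.mul_mul_mul_comm, ← pow_add, ← two_mul, hb,
          one_mul]
        calc s⁻¹ * r * (s⁻¹ * r) = r⁻¹ * s⁻¹ * (s⁻¹ * r) := by rw [h2]
          _ = r⁻¹ * (s * s)⁻¹ * r := by group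
          _ = g⁻¹ := by rw [hss, ← hgr.inv_inv.eq, mul_assoc, inv_mul_cancel, mul_one]
      · rw [hst, hgb.mul_pow, hr, one_mul, ← pow_mul, hbb']
      · rw [eq_top_iff, ← hsgen, Subgroup.closure_le]
        have h1 : g ∈ Subgroup.closure {g, s, s⁻¹ * (r * g ^ b)} :=
          Subgroup.subset_closure (by simp)
        have h2 : s ∈ Subgroup.closure {g, s, s⁻¹ * (r * g ^ b)} :=
          Subgroup.subset_closure (by simp)
        have h3 : s⁻¹ * (r * g ^ b) ∈ Subgroup.closure {g, s, s⁻¹ * (r * g ^ b)} :=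
          Subgroup.subset_closure (by simp)
        rintro a (rfl | rfl | rfl)
        · exact h1
        · have := mul_mem (mul_mem h2 h3) (inv_mem (pow_mem h1 b))
          rwa [hst, mul_inv_cancel_right] at this
        · exact h2
    -- For even `m` no twist is needed. For odd `m` the twist `b = n/2` gives `g^(b m) = g^(n/2)`,
    -- the relation of `G₄`.
    rcases Nat.even_or_odd m with hmeven | hmodd
    · exact Or.inl ⟨hmeven, hkey 0 0 (by simp) (by simp)⟩
    · refine Or.inr ⟨hmodd, hkey (n / 2) (n / 2) ?_ ?_⟩
      · rw [Nat.two_mul_div_two_of_even hneven, hgn]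
      · obtain ⟨q, hq⟩ := hmodd
        have h1 : n / 2 * m = n * q + n / 2 := by
          have := Nat.two_mul_div_two_of_even hneven
          rw [hq]
          linear_combination q * this
        rw [h1, pow_add, pow_mul, hgn, one_pow, one_mul]

end GroupTheory

/-! ### The polynomial `f` and its function field. -/

section Curve

variable {k : Type*} [Field k]

theorem hPoly_lower_degree_lt {n : ℕ} (hn : 1 ≤ n) (c : ℕ → k) :
    (∑ j ∈ Finset.Ico 1 n, C (c j) * X ^ (n - j) + 1 : k[X]).degree < n := by
  refine lt_of_le_of_lt (degree_add_le _ _) (max_lt ?_ ?_)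
  · refine lt_of_le_of_lt (degree_sum_le _ _) ((Finset.sup_lt_iff (WithBot.bot_lt_coe n)).2 ?_)
    intro j hj
    rw [Finset.mem_Ico] at hj
    exact lt_of_le_of_lt (degree_C_mul_X_pow_le _ _) (Nat.cast_lt.2 (by omega : n - j < n))
  · rw [degree_one]; exact_mod_cast hn

theorem monic_hPoly {n : ℕ} (hn : 1 ≤ n) (c : ℕ → k) : (hPoly n c).Monic := by
  rw [hPoly, add_assoc]
  exact monic_X_pow_add (hPoly_lower_degree_lt hn c)

theorem natDegree_hPoly {n : ℕ} (hn : 1 ≤ n) (c : ℕ → k) : (hPoly n c).natDegree = n := by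
  rw [hPoly, add_assoc]
  refine natDegree_eq_of_degree_eq_some ?_
  rw [degree_add_eq_left_of_degree_lt, degree_X_pow]
  rw [degree_X_pow]
  exact hPoly_lower_degree_lt hn c

theorem eval_zero_hPoly {n : ℕ} (hn : 1 ≤ n) (c : ℕ → k) : (hPoly n c).eval 0 = 1 := by
  rw [hPoly, eval_add, eval_add, eval_finsetSum, eval_one, Finset.sum_eq_zero]
  · simp [show n ≠ 0 by omega]
  · intro j hj
    rw [Finset.mem_Ico] at hj
    simp [show n - j ≠ 0 by omega]

variable {n lam m : ℕ}

theorem monic_curvePoly (hn : 1 ≤ n) (hm : 1 ≤ m) (c : Fin lam → ℕ → k) :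
    (curvePoly n lam m c).Monic := by
  refine monic_prod_of_monic _ _ fun i _ => ?_
  exact (monic_hPoly hn (c i)).comp (monic_X_pow m) (by rw [natDegree_X_pow]; omega)

theorem natDegree_curvePoly (hn : 1 ≤ n) (hm : 1 ≤ m) (c : Fin lam → ℕ → k) :
    (curvePoly n lam m c).natDegree = n * (lam * m) := by
  rw [curvePoly, natDegree_prod_of_monic _ _ fun i _ => (monic_hPoly hn (c i)).comp (monic_X_pow m)
    (by rw [natDegree_X_pow]; omega)]
  simp only [natDegree_comp, natDegree_hPoly hn, natDegree_X_pow, Finset.sum_const,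
    Finset.card_univ, Fintype.card_fin, smul_eq_mul]
  ring

theorem coeff_zero_curvePoly (hn : 1 ≤ n) (hm : 1 ≤ m) (c : Fin lam → ℕ → k) :
    (curvePoly n lam m c).coeff 0 = 1 := by
  rw [coeff_zero_eq_eval_zero, curvePoly, eval_prod, Finset.prod_eq_one]
  intro i _
  rw [eval_comp, eval_pow, eval_X, zero_pow (by omega), eval_zero_hPoly hn]

theorem aeval_curvePoly_mul {A : Type*} [CommRing A] [Algebra k A] (c : Fin lam → ℕ → k)
    {ξ : A} (hξ : ξ ^ m = 1) (x : A) :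
    aeval (ξ * x) (curvePoly n lam m c) = aeval x (curvePoly n lam m c) := by
  simp only [curvePoly, map_prod, aeval_comp, map_pow, aeval_X, mul_pow, hξ, one_mul]

/-- If the characteristic divided `m`, the factor `h(X^m)` would have zero derivative. This is what
provides a primitive `m`-th root of unity. -/
theorem cast_ne_zero_of_separable_curvePoly (hn : 1 ≤ n) (hm : 1 ≤ m) (hlam : 1 ≤ lam)
    {c : Fin lam → ℕ → k} (hsep : (curvePoly n lam m c).Separable) : (m : k) ≠ 0 := by
  intro h0
  set p := (hPoly n (c ⟨0, hlam⟩)).comp (X ^ m) with hp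
  have hpsep : p.Separable := hsep.of_dvd (Finset.dvd_prod_of_mem _ (Finset.mem_univ _))
  have hder : derivative p = 0 := by
    rw [hp, derivative_comp, derivative_X_pow, h0, C_0, zero_mul, zero_mul]
  rw [Separable, hder, isCoprime_zero_right] at hpsep
  have h1 := natDegree_eq_zero_of_isUnit hpsep
  rw [hp, natDegree_comp, natDegree_hPoly hn, natDegree_X_pow] at h1
  have : 0 < n * m := by positivity
  omega

/-- Eisenstein at the simple root `a`, then Gauss's lemma. -/
theorem irreducible_X_pow_sub_C {f : k[X]} (hn : 1 ≤ n) (hsep : f.Separable) (hf0 : f ≠ 0) {a : k}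
    (ha : f.IsRoot a) :
    Irreducible ((X : (RatFunc k)[X]) ^ n - C (algebraMap k[X] (RatFunc k) f)) := by
  have hmonic : (X ^ n - C f : k[X][X]).Monic := monic_X_pow_sub_C f (by omega)
  have hirr : Irreducible (X ^ n - C f : k[X][X]) := by
    refine irreducible_of_eisenstein_criterion (P := Ideal.span {X - C a})
      ((Ideal.span_singleton_prime (X_sub_C_ne_zero a)).2 (prime_X_sub_C a)) ?_ ?_ ?_ ?_
      hmonic.isPrimitive
    · rw [hmonic.leadingCoeff, ← Ideal.eq_top_iff_one, Ideal.span_singleton_eq_top]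
      exact not_isUnit_X_sub_C a
    · intro i hi
      rw [degree_X_pow_sub_C (by omega)] at hi
      have hi' : i < n := by exact_mod_cast hi
      rw [coeff_sub, coeff_X_pow, if_neg (by omega), zero_sub, neg_mem_iff, coeff_C]
      split_ifs
      · exact Ideal.mem_span_singleton.2 (dvd_iff_isRoot.2 ha)
      · exact zero_mem _
    · rw [degree_X_pow_sub_C (by omega)]
      exact_mod_cast hn
    · rw [coeff_sub, coeff_X_pow, coeff_C_zero, if_neg (by omega), zero_sub, neg_mem_iff,
        Ideal.span_singleton_pow, Ideal.mem_span_singleton, ← le_rootMultiplicity_iff hf0]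
      have := rootMultiplicity_le_one_of_separable hsep a
      omega
  have := (hmonic.irreducible_iff_irreducible_map_fraction_map (K := RatFunc k)).1 hirr
  simpa using this

theorem superellipticField_aeval {f : k[X]} (p : k[X]) :
    aeval (AdjoinRoot.of ((X : (RatFunc k)[X]) ^ n - C (algebraMap k[X] (RatFunc k) f))
      RatFunc.X) p = AdjoinRoot.of _ (algebraMap k[X] (RatFunc k) p) := by
  have h1 := aeval_algHom_apply
    (IsScalarTower.toAlgHom k (RatFunc k) (SuperellipticField n f)) RatFunc.X p
  rw [IsScalarTower.coe_toAlgHom'] at h1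
  rw [← AdjoinRoot.algebraMap_eq, h1]
  congr 1
  rw [← RatFunc.algebraMap_X, aeval_algebraMap_apply, aeval_X_left_apply]

theorem superellipticField_exists_coeff {f : k[X]} (hn : 1 ≤ n) (u : SuperellipticField n f) :
    ∃ D : k[X], D ≠ 0 ∧ ∃ Q : ℕ → k[X],
      aeval (AdjoinRoot.of ((X : (RatFunc k)[X]) ^ n - C (algebraMap k[X] (RatFunc k) f))
        RatFunc.X) D * u = ∑ b ∈ Finset.range n,
      aeval (AdjoinRoot.of ((X : (RatFunc k)[X]) ^ n - C (algebraMap k[X] (RatFunc k) f))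
        RatFunc.X) (Q b) * (AdjoinRoot.root _) ^ b := by
  have hmonic : ((X : (RatFunc k)[X]) ^ n - C (algebraMap k[X] (RatFunc k) f)).Monic :=
    monic_X_pow_sub_C _ (by omega)
  set g := (X : (RatFunc k)[X]) ^ n - C (algebraMap k[X] (RatFunc k) f) with hg
  have haeval : ∀ p : k[X], aeval (AdjoinRoot.of g RatFunc.X) p =
      AdjoinRoot.of g (algebraMap k[X] (RatFunc k) p) := superellipticField_aeval
  obtain ⟨p, rfl⟩ := AdjoinRoot.mk_surjective u
  have hr : AdjoinRoot.mk g p = AdjoinRoot.mk g (p %ₘ g) := by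
    rw [AdjoinRoot.mk_eq_mk]
    exact ⟨p /ₘ g, by linear_combination -modByMonic_add_div p g⟩
  have hdeg : (p %ₘ g).natDegree < n := by
    have hgn : g.natDegree = n := natDegree_X_pow_sub_C
    have := natDegree_modByMonic_lt p hmonic (by
      intro h1; rw [h1, natDegree_one] at hgn; omega)
    rwa [hgn] at this
  obtain ⟨D, hD⟩ := IsLocalization.exist_integer_multiples (nonZeroDivisors k[X])
    (Finset.range n) (fun i => (p %ₘ g).coeff i)
  choose! Q hQ using hD
  refine ⟨D, nonZeroDivisors.ne_zero D.2, Q, ?_⟩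
  rw [hr, haeval]
  conv_lhs => rw [as_sum_range' (p %ₘ g) n hdeg]
  rw [map_sum, Finset.mul_sum]
  refine Finset.sum_congr rfl fun i hi => ?_
  rw [haeval, hQ i hi, ← C_mul_X_pow_eq_monomial, map_mul, map_pow, AdjoinRoot.mk_X,
    AdjoinRoot.mk_C, ← mul_assoc, ← map_mul, Algebra.smul_def]

end Curve

/-! ### The covering structure and the scalings on the concrete function field. -/

section Curve

variable {k : Type*} [Field k] {n e : ℕ} {f : k[X]}

theorem isCyclicCover_superelliptic (hn : 2 ≤ n) (hchar : (n : k) ≠ 0) (he : 2 ≤ e)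
    (hgenus : 2 < (n - 1) * e) (hmonic : f.Monic) (hdeg : f.natDegree = n * e)
    (hsep : f.Separable) (ζ : kˣ) (hζ : IsPrimitiveRoot ζ n)
    [Fact (Irreducible ((X : (RatFunc k)[X]) ^ n - C (algebraMap k[X] (RatFunc k) f)))] :
    IsCyclicCover (F := SuperellipticField n f) n e f (ζ : k) (AdjoinRoot.of _ RatFunc.X)
      (AdjoinRoot.root _) (superellipticAut n f ζ hζ.pow_eq_one) where
  two_le := hn
  cast_ne_zero := hchar
  two_le_e := he
  genus := hgenus
  monic := hmonic
  natDegree_eq := hdeg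
  separable := hsep
  isPrimitiveRoot := IsPrimitiveRoot.coe_units_iff.2 hζ
  transcendental := by
    have h1 : Transcendental k (RatFunc.X : RatFunc k) := RatFunc.transcendental_X
    exact fun h2 => h1 ((isAlgebraic_algHom_iff
      (IsScalarTower.toAlgHom k (RatFunc k) (SuperellipticField n f))
      (algebraMap (RatFunc k) (SuperellipticField n f)).injective).1 h2)
  pow_eq := by
    have h0 := AdjoinRoot.eval₂_root ((X : (RatFunc k)[X]) ^ n -
      C (algebraMap k[X] (RatFunc k) f))
    rw [eval₂_sub, eval₂_X_pow, eval₂_C, sub_eq_zero] at h0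
    rw [h0, superellipticField_aeval]
  map_x := superellipticAut_of n f ζ _ _
  map_y := by rw [superellipticAut_root, Algebra.smul_def]
  exists_coeff := superellipticField_exists_coeff (by omega)

/-- Automorphisms `(x, y) ↦ (ξ x, y)` for `f(ξ x) = f(x)`. -/
theorem exists_scaling [Fact (Irreducible ((X : (RatFunc k)[X]) ^ n -
      C (algebraMap k[X] (RatFunc k) f)))] {ζ : k}
    {θ : SuperellipticField n f ≃ₐ[k] SuperellipticField n f}
    (h : IsCyclicCover (F := SuperellipticField n f) n e f ζ (AdjoinRoot.of _ RatFunc.X)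
      (AdjoinRoot.root _) θ) {m : ℕ} (hm : m ≠ 0)
    (hf : ∀ ξ : SuperellipticField n f, ξ ^ m = 1 → ∀ x, aeval (ξ * x) f = aeval x f) {ξ : k}
    (hξ : ξ ^ m = 1) :
    ∃ S : SuperellipticField n f ≃ₐ[k] SuperellipticField n f,
      S (AdjoinRoot.of _ RatFunc.X) = algebraMap k _ ξ * AdjoinRoot.of _ RatFunc.X ∧
      S (AdjoinRoot.root _) = AdjoinRoot.root _ := by
  have key : ∀ ξ : k, ξ ^ m = 1 → ∃ S : SuperellipticField n f →ₐ[k] SuperellipticField n f,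
      S (AdjoinRoot.of _ RatFunc.X) = algebraMap k _ ξ * AdjoinRoot.of _ RatFunc.X ∧
      S (AdjoinRoot.root _) = AdjoinRoot.root _ := by
    intro ξ hξ
    have hξF : (algebraMap k (SuperellipticField n f) ξ) ^ m = 1 := by
      rw [← map_pow, hξ, map_one]
    have hξ0 : ξ ≠ 0 := by
      rintro rfl
      rw [zero_pow hm] at hξ
      exact zero_ne_one hξ
    have hinj : Function.Injective (aeval (algebraMap k (SuperellipticField n f) ξ *
        AdjoinRoot.of _ RatFunc.X) : k[X] →ₐ[k] SuperellipticField n f) := by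
      rw [← transcendental_iff_injective]
      intro halg
      apply h.transcendental
      have h1 := (isAlgebraic_algebraMap (A := SuperellipticField n f) ξ⁻¹).mul halg
      rwa [← mul_assoc, ← map_mul, inv_mul_cancel₀ hξ0, map_one, one_mul] at h1
    let ψ : RatFunc k →ₐ[k] SuperellipticField n f := RatFunc.liftAlgHom
      (aeval (algebraMap k (SuperellipticField n f) ξ * AdjoinRoot.of _ RatFunc.X))
      (nonZeroDivisors_le_comap_nonZeroDivisors_of_injective _ hinj)
    have hψ : ∀ p : k[X], ψ (algebraMap k[X] (RatFunc k) p) =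
        aeval (algebraMap k (SuperellipticField n f) ξ * AdjoinRoot.of _ RatFunc.X) p := by
      intro p
      have h1 := RatFunc.liftAlgHom_apply_div _
        (nonZeroDivisors_le_comap_nonZeroDivisors_of_injective _ hinj) p 1
      rwa [map_one, div_one, map_one, div_one] at h1
    refine ⟨AdjoinRoot.liftAlgHom _ ψ (AdjoinRoot.root _) ?_, ?_, ?_⟩
    · rw [eval₂_sub, eval₂_X_pow, eval₂_C, sub_eq_zero, h.pow_eq]
      exact ((hψ f).trans (hf _ hξF _)).symm
    · rw [AdjoinRoot.liftAlgHom_of, ← RatFunc.algebraMap_X, hψ, aeval_X, RatFunc.algebraMap_X]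
    · exact AdjoinRoot.liftAlgHom_root _ _ _ _
  obtain ⟨S, hSx, hSy⟩ := key ξ hξ
  obtain ⟨S', hSx', hSy'⟩ := key ξ⁻¹ (by rw [inv_pow, hξ, inv_one])
  have hξ0 : ξ ≠ 0 := by
    rintro rfl
    rw [zero_pow hm] at hξ
    exact zero_ne_one hξ
  refine ⟨AlgEquiv.ofAlgHom S S' (h.algHom_ext ?_ ?_) (h.algHom_ext ?_ ?_), hSx, hSy⟩
  · rw [AlgHom.comp_apply, hSx', map_mul, AlgHom.commutes, hSx, ← mul_assoc, ← map_mul,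
      inv_mul_cancel₀ hξ0, map_one, one_mul, AlgHom.id_apply]
  · rw [AlgHom.comp_apply, hSy', hSy, AlgHom.id_apply]
  · rw [AlgHom.comp_apply, hSx, map_mul, AlgHom.commutes, hSx', ← mul_assoc, ← map_mul,
      mul_inv_cancel₀ hξ0, map_one, one_mul, AlgHom.id_apply]
  · rw [AlgHom.comp_apply, hSy, hSy', AlgHom.id_apply]

end Curve

/-! ### The classification. -/

theorem mainTheorem8 {k : Type*} [Field k] [IsAlgClosed k]
    (n lam m : ℕ) (hn : 2 ≤ n) (hchar : (n : k) ≠ 0) (hlam : 1 ≤ lam) (hm : 2 ≤ m)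
    -- the genus `1 + (n / 2) * ((n - 1) * lam * m - 2)` is at least two
    (hgenus : 2 < (n - 1) * lam * m)
    (c : Fin lam → ℕ → k) (hsep : (curvePoly n lam m c).Separable)
    (ζ : kˣ) (hζ : IsPrimitiveRoot ζ n) :
    ∃ _ : (Subgroup.zpowers
        (superellipticAut n (curvePoly n lam m c) ζ hζ.pow_eq_one)).Normal,
      -- reduced automorphism group `C_m`
      (Nonempty ((CurveAut n (curvePoly n lam m c) ⧸ Subgroup.zpowers
            (superellipticAut n (curvePoly n lam m c) ζ hζ.pow_eq_one)) ≃* CyclicGrp m) →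
        Nonempty (CurveAut n (curvePoly n lam m c) ≃* CyclicGrp (m * n)) ∨
        ∃ l : ℕ, l.Coprime n ∧ l ^ m ≡ 1 [MOD n] ∧ (m.Coprime n → l = n - 1) ∧
          Nonempty (CurveAut n (curvePoly n lam m c) ≃* MetacyclicGrp n m l)) ∧
      -- reduced automorphism group `D_{2m}`, of order `2 * m`
      (Nonempty ((CurveAut n (curvePoly n lam m c) ⧸ Subgroup.zpowers
            (superellipticAut n (curvePoly n lam m c) ζ hζ.pow_eq_one)) ≃* DihedralGroup m) →
        (Odd n →
          Nonempty (CurveAut n (curvePoly n lam m c) ≃* DihedralGroup m × CyclicGrp n)) ∧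
        (Even n → Odd m →
          Nonempty (CurveAut n (curvePoly n lam m c) ≃* DihedralGroup m × CyclicGrp n) ∨
          Nonempty (CurveAut n (curvePoly n lam m c) ≃* GroupG4 n m)) ∧
        (Even n → Even m →
          Nonempty (CurveAut n (curvePoly n lam m c) ≃* DihedralGroup m × CyclicGrp n) ∨
          Nonempty (CurveAut n (curvePoly n lam m c) ≃* DihedralGroup (m * n)) ∨
          Nonempty (CurveAut n (curvePoly n lam m c) ≃* GroupG1 n m) ∨
          Nonempty (CurveAut n (curvePoly n lam m c) ≃* GroupG2 n m) ∨
          Nonempty (CurveAut n (curvePoly n lam m c) ≃* GroupG3 n m) ∨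
          Nonempty (CurveAut n (curvePoly n lam m c) ≃* GroupG4 n m))) := by
  have hn1 : 1 ≤ n := by omega
  have hm1 : 1 ≤ m := by omega
  have hn0 : n ≠ 0 := by omega
  have hm0 : m ≠ 0 := by omega
  have hmonic := monic_curvePoly hn1 hm1 c
  have hdeg := natDegree_curvePoly hn1 hm1 c
  have hf0 := coeff_zero_curvePoly hn1 hm1 c
  have hmk := cast_ne_zero_of_separable_curvePoly hn1 hm1 hlam hsep
  have hf : ∀ ξ : SuperellipticField n (curvePoly n lam m c), ξ ^ m = 1 → ∀ x,
      aeval (ξ * x) (curvePoly n lam m c) = aeval x (curvePoly n lam m c) :=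
    fun ξ hξ x => aeval_curvePoly_mul c hξ x
  generalize curvePoly n lam m c = f at *
  obtain ⟨a, ha⟩ := IsAlgClosed.exists_root f (by
    rw [degree_eq_natDegree hmonic.ne_zero, hdeg]
    exact_mod_cast (by positivity : n * (lam * m) ≠ 0))
  have : Fact (Irreducible ((X : (RatFunc k)[X]) ^ n - C (algebraMap k[X] (RatFunc k) f))) :=
    ⟨irreducible_X_pow_sub_C hn1 hsep hmonic.ne_zero ha⟩
  have h := isCyclicCover_superelliptic hn hchar (e := lam * m) (by nlinarith)
    (by rwa [← mul_assoc]) hmonic hdeg hsep ζ hζ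
  have : NeZero (m : k) := ⟨hmk⟩
  obtain ⟨ξ, hξ⟩ := HasEnoughRootsOfUnity.exists_primitiveRoot k m
  obtain ⟨S, hSx, hSy⟩ := exists_scaling h hm0 hf hξ.pow_eq_one
  have hθS : Commute (superellipticAut n f ζ hζ.pow_eq_one) S := by
    refine h.algEquiv_ext ?_ ?_
    · rw [AlgEquiv.mul_apply, AlgEquiv.mul_apply, hSx, map_mul, AlgEquiv.commutes, h.map_x, hSx]
    · rw [AlgEquiv.mul_apply, AlgEquiv.mul_apply, hSy, h.map_y, map_mul, AlgEquiv.commutes, hSy]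
  have hSmem := h.pow_mem_zpowers_iff hξ hSx
  have hSm : S ^ m = 1 := by
    have hpow : ∀ i : ℕ, (S ^ i) (AdjoinRoot.root _) = AdjoinRoot.root _ := fun i =>
      (pow_mem (show S ∈ MulAction.stabilizer (CurveAut n f) (AdjoinRoot.root
        ((X : (RatFunc k)[X]) ^ n - C (algebraMap k[X] (RatFunc k) f))) from hSy) i)
    exact h.algEquiv_ext (h.mem_zpowers_iff.1 ((hSmem m).2 dvd_rfl)) (hpow m)
  have hnormal := h.normal_zpowers
  have hord := h.orderOf_eq
  refine ⟨hnormal, ?_, ?_⟩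
  · rintro ⟨e⟩
    have hcard := Nat.card_congr e.toEquiv
    rw [Nat.card_congr Multiplicative.toAdd, Nat.card_zmod] at hcard
    rcases mulEquiv_of_cyclic_quotient hn0 hm0 hord hθS hSm hSmem hcard with
      ⟨-, hiso⟩ | ⟨hcop, hiso⟩
    · exact Or.inl hiso
    -- The extension is abelian, so `l = 1`. The clause on coprime `m` and `n` is void, that case
    -- being cyclic.
    · exact Or.inr ⟨1, Nat.coprime_one_left n, by rw [one_pow], fun hc => absurd hc hcop, hiso⟩
  · rintro ⟨e⟩
    have hcard := Nat.card_congr e.toEquiv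
    rw [DihedralGroup.nat_card] at hcard
    obtain ⟨T, hTT, hST, hT⟩ := exists_lift_of_dihedral_quotient hm hSmem e
    obtain ⟨T', hconj, hTT', hTT'mem, hθT'⟩ := h.exists_dihedral_lift hf0
      (hξ.ne_one (by omega)) (by rw [mul_comm, pow_mul, hξ.pow_eq_one, one_pow]) hSx hSy hTT hST
      (fun i hi => hT ⟨-i, by
        rw [← QuotientGroup.eq_one_iff, QuotientGroup.mk_mul, QuotientGroup.mk_pow,
          mul_eq_one_iff_eq_inv] at hi
        simp only [hi, zpow_neg, zpow_natCast]⟩)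
    -- The normalised lift lies in the same coset of `⟨θ⟩` as `T`.
    rw [QuotientGroup.eq.2 hTT'mem] at hT
    have hgen := closure_eq_top_of_dihedral_quotient hm0 hSmem hcard hT
    rcases mulEquiv_of_dihedral_quotient hn0 hm0 hord hSm hθS hθT' hconj hTT' hgen
      (by rw [card_eq_of_quotient hord hcard]; ring) with hiso | ⟨heven, ⟨hme, hiso⟩ | ⟨hmo, hiso⟩⟩
    · exact ⟨fun _ => hiso, fun _ _ => Or.inl hiso, fun _ _ => Or.inl hiso⟩
    · refine ⟨fun ho => absurd heven (Nat.not_even_iff_odd.2 ho),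
        fun _ ho => absurd hme (Nat.not_even_iff_odd.2 ho), fun _ _ => ?_⟩
      exact Or.inr (Or.inr (Or.inr (Or.inl hiso)))
    · exact ⟨fun ho => absurd heven (Nat.not_even_iff_odd.2 ho), fun _ _ => Or.inr hiso,
        fun _ hme => absurd hme (Nat.not_even_iff_odd.2 hmo)⟩
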